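/- Let $s:\mathbb R\to\mathbb R$ be a smooth function with $s\equiv 0$ on $[0,\frac14]$, $s$ increasing on $[\frac14,\frac34]$, $s\equiv 1$ on $[\frac34,1]$, $s(\frac12)=\frac12$, $s'(\frac12)=2$, $s''(\frac12)=0$ (such functions exist). For $n\ge 1$ let $r_n=\frac1{\ln(n+1)}$, $A_n=\{z\in\mathbb C: r_{n+1}\le|z|\le r_n\}$ and $\chi_n(z)=s\left(\frac{|z|-r_{n+1}}{r_n-r_{n+1}}\right)$; for $n\ge0$ let $p(n)=n^2$ and $$F(n)=\left[\prod_{j=2}^{n}(\ln(j+2))^{j-1}\right]^2=\left[(\ln(n+2))^{n-1}(\ln(n+1))^{n-2}\cdots(\ln 5)^2(\ln 4)^1\right]^2,$$ so that $F(0)=F(1)=1$. Let $D=\{z\in\mathbb C:|z|\le r_1\}=\{0\}\cup\bigcup_{n\ge1}A_n$, and define $u=(u^1,u^2):D\to\mathbb C^2$ by $u(0)=0$ and, for $z\in A_n$ with $n$ even, $$u^1(z)=F(n)z^{p(n)},\qquad u^2(z)=\chi_n(z)F(n-1)z^{p(n-1)}+(1-\chi_n(z))F(n+1)z^{p(n+1)},$$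 with the formulas for $u^1$ and $u^2$ exchanged for $n$ odd (the formulas agree where two annuli meet). Write $u_z=\frac12(u_x-iu_y)$ and $u_{\bar z}=\frac12(u_x+iu_y)$, and say that a function $f$ vanishes to infinite order at $0$ if $\|f(z)\|/|z|^k\to0$ as $z\to0$ for every integer $k\ge0$. Then, for every such $s$: 1. $u$ is $C^\infty$ on $D$, $u(z)\ne0$ for all $z\in D\setminus\{0\}$, and $u$ vanishes to infinite order at $0$; thus $0$ is an isolated zero of $u$ of infinite order. 2. $u_z(z)\neq 0$ for all $z\in D\setminus\{0\}$, and there is a constant $C>0$ such that $$\frac{\|u_{\bar z}(z)\|}{\|u_z(z)\|}\le\frac{C}{|z|^2e^{1/|z|}}\qquad\text{for all }z\in D\setminus\{0\};$$ in particular the ratio $\|u_{\bar z}\|/\|u_z\|$ vanishes to infinite order at $0$. 3. Let $Q(z)$ be the complex $2\times2$ matrix with entries $q_{ij}(z)=u^i_{\bar z}\,\overline{u^j_z}/\|u_z\|^2$ for $z\in D\setminus\{0\}$, and $Q(0)=0$. Then $Q$ is continuous on $D$, each $q_{ij}$ vanishes to infinite order at $0$, $u$ satisfies the Beltrami-type system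 $u_{\bar z}=Q(z)u_z$ on $D$, and the operator $\frac{\partial}{\partial\bar z}-Q(z)\frac{\partial}{\partial z}$ is uniformly elliptic on some disk $\{|z|<\rho\}$ with $0<\rho\le r_1$, that is, for some $c>0$, $\|\zeta w-\bar\zeta Q(z)w\|\ge c|\zeta|\|w\|$ for all $|z|<\rho$, $\zeta\in\mathbb C$, $w\in\mathbb C^2$. The system does not have the strong unique continuation property: for every $0<\rho\le r_1$ it has a $C^\infty$ solution on $\{|z|<\rho\}$ (namely $u$) that vanishes to infinite order at $0$ but does not vanish identically on any neighborhood of $0$. -/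

import Mathlib

open Set Filter Topology Metric
open scoped ContDiff ComplexConjugate

/-- The one-variable cutoff profile: smooth on `ℝ`, `0` on `[0,1/4]`, increasing on `[1/4,3/4]`,
`1` on `[3/4,1]`, with `s(1/2) = 1/2`, `s'(1/2) = 2`, `s''(1/2) = 0`. -/
structure IsCutoffProfile (s : ℝ → ℝ) : Prop where
  smooth : ContDiff ℝ ∞ s
  eq_zero : ∀ x ∈ Icc (0 : ℝ) (1 / 4), s x = 0
  mono : MonotoneOn s (Icc (1 / 4) (3 / 4))
  half : s (1 / 2) = 1 / 2
  deriv_half : deriv s (1 / 2) = 2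
  deriv_two_half : iteratedDeriv 2 s (1 / 2) = 0
  eq_one : ∀ x ∈ Icc (3 / 4 : ℝ) 1, s x = 1

/-- The closed annulus `A_n = {z : r_{n+1} ≤ |z| ≤ r_n}`. -/
def annulus (r : ℕ → ℝ) (n : ℕ) : Set ℂ := {z | r (n + 1) ≤ ‖z‖ ∧ ‖z‖ ≤ r n}

/-- The annular cutoff function `χ_n(z) = s((|z| - r_{n+1}) / (r_n - r_{n+1}))`. -/
noncomputable def annularCutoff (s : ℝ → ℝ) (r : ℕ → ℝ) (n : ℕ) (z : ℂ) : ℝ :=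
  s ((‖z‖ - r (n + 1)) / (r n - r (n + 1)))

/-- The component `F(n) z^{p(n)}` (the first one for even `n`, the second one for odd `n`). -/
noncomputable def powerPart (p : ℕ → ℕ) (F : ℕ → ℝ) (n : ℕ) (z : ℂ) : ℂ :=
  (F n : ℂ) * z ^ p n

/-- The component `χ_n(z) F(n-1) z^{p(n-1)} + (1 - χ_n(z)) F(n+1) z^{p(n+1)}`
(the second one for even `n`, the first one for odd `n`); used for `n ≥ 1` only. -/
noncomputable def transitionPart (s : ℝ → ℝ) (r : ℕ → ℝ) (p : ℕ → ℕ) (F : ℕ → ℝ) (n : ℕ) (z : ℂ) :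
    ℂ :=
  (annularCutoff s r n z : ℂ) * powerPart p F (n - 1) z
    + (1 - (annularCutoff s r n z : ℂ)) * powerPart p F (n + 1) z

/-- The formula that defines the map on the annulus `A_n`. -/
noncomputable def annularPiece (s : ℝ → ℝ) (r : ℕ → ℝ) (p : ℕ → ℕ) (F : ℕ → ℝ) (n : ℕ) (z : ℂ) :
    EuclideanSpace ℂ (Fin 2) :=
  open Classical in
  if Even n then !₂[powerPart p F n z, transitionPart s r p F n z]
  else !₂[transitionPart s r p F n z, powerPart p F n z]

/-- The map `u` of the annular cutoff construction: given by `annularPiece` on each annulus `A_n`,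
`n ≥ 1`, and `0` elsewhere (in the disk of radius `r_1`, only at the origin).  The choice of `n`
does not matter on overlaps, see `annularMap_eq`. -/
noncomputable def annularMap (s : ℝ → ℝ) (r : ℕ → ℝ) (p : ℕ → ℕ) (F : ℕ → ℝ) (z : ℂ) :
    EuclideanSpace ℂ (Fin 2) :=
  open Classical in
  if h : ∃ n, 1 ≤ n ∧ z ∈ annulus r n then annularPiece s r p F h.choose z else 0

/-- Two consecutive formulas agree on the common boundary circle. -/
theorem annularPiece_succ {s : ℝ → ℝ} {r : ℕ → ℝ} (p : ℕ → ℕ) (F : ℕ → ℝ) (h0 : s 0 = 0)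
    (h1 : s 1 = 1) {n : ℕ} (hn : r (n + 1 + 1) < r (n + 1)) {z : ℂ} (hz : ‖z‖ = r (n + 1)) :
    annularPiece s r p F n z = annularPiece s r p F (n + 1) z := by
  have e1 : annularCutoff s r n z = 0 := by simp [annularCutoff, hz, h0]
  have e2 : annularCutoff s r (n + 1) z = 1 := by
    rw [annularCutoff, hz, div_self (by linarith), h1]
  by_cases hp : Even n
  · have hq : ¬ Even (n + 1) := by simpa [Nat.even_add_one] using hp
    simp [annularPiece, transitionPart, e1, e2, hp, hq]
  · have hq : Even (n + 1) := by simpa [Nat.even_add_one] using hp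
    simp [annularPiece, transitionPart, e1, e2, hp, hq]

/-- The map is well defined: it is given by the `n`-th formula on all of `A_n`. -/
theorem annularMap_eq {s : ℝ → ℝ} {r : ℕ → ℝ} (p : ℕ → ℕ) (F : ℕ → ℝ) (h0 : s 0 = 0)
    (h1 : s 1 = 1) (hr : ∀ n, 1 ≤ n → r (n + 1) < r n) {n : ℕ} (hn : 1 ≤ n) {z : ℂ}
    (hz : z ∈ annulus r n) : annularMap s r p F z = annularPiece s r p F n z := by
  have hlt : ∀ a, 1 ≤ a → ∀ b, a < b → r b < r a := by
    intro a ha b hab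
    induction b, hab using Nat.le_induction with
    | base => exact hr a ha
    | succ b hb ih => exact (hr b (by omega)).trans ih
  have key : ∀ a b : ℕ, 1 ≤ a → a < b → z ∈ annulus r a → z ∈ annulus r b →
      annularPiece s r p F a z = annularPiece s r p F b z := by
    intro a b ha hab hza hzb
    have hb : b = a + 1 := by
      by_contra hne
      have := hlt (a + 1) (by omega) b (by omega)
      linarith [hza.1, hzb.2]
    subst hb
    exact annularPiece_succ p F h0 h1 (hr _ (by omega)) (le_antisymm hzb.2 hza.1)
  have h : ∃ n, 1 ≤ n ∧ z ∈ annulus r n := ⟨n, hn, hz⟩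
  have hm := h.choose_spec
  rw [annularMap, dif_pos h]
  rcases lt_trichotomy h.choose n with hl | he | hg
  · exact key _ _ hm.1 hl hm.2 hz
  · rw [he]
  · exact (key _ _ hn hg hz hm.2).symm

/-- `r_n = 1 / ln(n+1)`, used for `n ≥ 1`. -/
noncomputable def logRadius (n : ℕ) : ℝ := 1 / Real.log ((n : ℝ) + 1)

/-- `F(n) = [(ln(n+2))^{n-1} (ln(n+1))^{n-2} ⋯ (ln 5)^2 (ln 4)^1]^2`, with the empty product `1`
for `n = 0, 1`. -/
noncomputable def logCoeff (n : ℕ) : ℝ :=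
  (∏ j ∈ Finset.Icc 2 n, Real.log ((j : ℝ) + 2) ^ (j - 1)) ^ 2

/-- The map `u` for `r_n = 1 / ln(n+1)`, `p(n) = n^2`, `F = logCoeff`. -/
noncomputable def logMap (s : ℝ → ℝ) : ℂ → EuclideanSpace ℂ (Fin 2) :=
  annularMap s logRadius (fun n => n ^ 2) logCoeff

/-- The derivative `f_z = (f_x - i f_y) / 2` on the domain `S` (one-sided at boundary points). -/
noncomputable def wirtingerZ (S : Set ℂ) (f : ℂ → EuclideanSpace ℂ (Fin 2)) (z : ℂ) :
    EuclideanSpace ℂ (Fin 2) :=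
  (1 / 2 : ℂ) • (fderivWithin ℝ f S z 1 - Complex.I • fderivWithin ℝ f S z Complex.I)

/-- The derivative `f_{z̄} = (f_x + i f_y) / 2` on the domain `S` (one-sided at boundary points). -/
noncomputable def wirtingerZBar (S : Set ℂ) (f : ℂ → EuclideanSpace ℂ (Fin 2)) (z : ℂ) :
    EuclideanSpace ℂ (Fin 2) :=
  (1 / 2 : ℂ) • (fderivWithin ℝ f S z 1 + Complex.I • fderivWithin ℝ f S z Complex.I)

/-- `f` vanishes to infinite order at the origin: `|z|^{-k} ‖f(z)‖ → 0` for all `k ≥ 0`. -/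
def VanishesToInfiniteOrder {E : Type*} [NormedAddCommGroup E] (f : ℂ → E) : Prop :=
  ∀ k : ℕ, Tendsto (fun z => ‖f z‖ / ‖z‖ ^ k) (𝓝[≠] 0) (𝓝 0)

/-- The coefficient matrix with entries `u^i_{z̄} conj(u^j_z) / ‖u_z‖²` away from the origin, and
`0` at the origin. -/
noncomputable def beltramiMatrix (S : Set ℂ) (u : ℂ → EuclideanSpace ℂ (Fin 2)) (z : ℂ) :
    Matrix (Fin 2) (Fin 2) ℂ :=
  open Classical in
  if z = 0 then 0
  else Matrix.of fun i j =>
    wirtingerZBar S u z i * conj (wirtingerZ S u z j) / ((‖wirtingerZ S u z‖ : ℂ) ^ 2)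

/-- `v` solves the Beltrami-type system `v_{z̄} = Q(z) v_z` on `S`. -/
def SolvesBeltrami (Q : ℂ → Matrix (Fin 2) (Fin 2) ℂ) (S : Set ℂ)
    (v : ℂ → EuclideanSpace ℂ (Fin 2)) : Prop :=
  ∀ z ∈ S, ∀ i, wirtingerZBar S v z i = ∑ j, Q z i j * wirtingerZ S v z j

/-- Uniform ellipticity on `S` of the operator `∂/∂z̄ - Q(z) ∂/∂z`, whose principal symbol at the
real covector `(ξ, η)` is, up to the factor `i/2`, the matrix `ζ I - conj(ζ) Q(z)` with
`ζ = ξ + i η`. -/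
def IsUniformlyElliptic (Q : ℂ → Matrix (Fin 2) (Fin 2) ℂ) (S : Set ℂ) : Prop :=
  ∃ c : ℝ, 0 < c ∧ ∀ z ∈ S, ∀ (ζ : ℂ) (w : EuclideanSpace ℂ (Fin 2)),
    c * ‖ζ‖ * ‖w‖ ≤
      ‖(WithLp.toLp 2 fun i => ζ * w i - conj ζ * ∑ j, Q z i j * w j :
        EuclideanSpace ℂ (Fin 2))‖

/-- Strong unique continuation at the origin for `v_{z̄} = Q(z) v_z` on an open set `U` that contains
the origin: every smooth solution on `U` that vanishes to infinite order at the origin vanishes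
identically near the origin. -/
def HasStrongUniqueContinuation (Q : ℂ → Matrix (Fin 2) (Fin 2) ℂ) (U : Set ℂ) : Prop :=
  ∀ v : ℂ → EuclideanSpace ℂ (Fin 2), ContDiffOn ℝ ∞ v U → SolvesBeltrami Q U v →
    VanishesToInfiniteOrder v → ∀ᶠ z in 𝓝 (0 : ℂ), v z = 0

/-!
Write `r n = logRadius n` and `F n = logCoeff n`.  On the `n`-th annulus one component of the map is
the monomial `F n * z ^ n ^ 2`, and the other one interpolates between the two neighbouring
monomials.  Everything rests on how these monomials compare there.

* The coefficients are chosen so that on the `n`-th annulus both neighbours of `F n * z ^ n ^ 2` are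
  at most a constant times `F n * |z| ^ (n ^ 2 - 1)`, which is the modulus of the derivative of the
  middle one divided by `n ^ 2` (`exists_norm_powerPart_neighbours_le`).  Only the derivative of the
  cutoff, of size `1 / (r n - r (n + 1)) ≈ n * (ln n) ^ 2`, contributes to `u_{z̄}`, and the monomial
  alone bounds `u_z` from below.  So `|u_{z̄}| / |u_z|` is of order `(ln n) ^ 2 / n`, and
  `1 / |z| ≈ ln n` turns this into the bound `C / (|z| ^ 2 * exp (1 / |z|))`
  (`exists_norm_wirtingerZBar_smoothLogMap_le`).
* On the support of its cutoff the `n`-th monomial is `O(exp (-n))`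
  (`eventually_logCoeff_mul_pow_le`), while each differentiation costs only a power of `n`
  (`exists_bound_iteratedFDeriv_cutoffMonomial`).  The map is therefore the sum of a series of smooth
  functions, on the whole plane, that converges uniformly with all derivatives
  (`contDiff_smoothLogMap`).  This gives smoothness up to the origin and the boundary circle without
  a study of derivatives at the origin, and reduces one-sided derivatives to ordinary ones.

The matrix `Q` is the rank one operator that sends `u_z` to `u_{z̄}`, and its entries are bounded by
the ratio `|u_{z̄}| / |u_z|`.  The properties of `Q` follow from the flatness of this ratio, and `u`
itself violates strong unique continuation.
-/

/-! ### Cutoff profiles -/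

/-- The profile `E(4x - 1) / (E(4x - 1) + E(3 - 4x))` with `E(y) = exp(-1/y)` for `y > 0`.  It is
symmetric about `1/2`, which forces the value `1/2` and a vanishing second derivative there; the
scaling inside `E` is the one that makes the slope at `1/2` equal to `2`. -/
theorem exists_isCutoffProfile : ∃ s : ℝ → ℝ, IsCutoffProfile s := by
  set E := expNegInvGlue with hE
  have hsm : ContDiff ℝ ∞ E := expNegInvGlue.contDiff
  have hpos : ∀ x : ℝ, 0 < E (4 * x - 1) + E (3 - 4 * x) := by
    intro x
    rcases le_or_gt x (1 / 2) with h | h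
    · exact add_pos_of_nonneg_of_pos (expNegInvGlue.nonneg _)
        (expNegInvGlue.pos_of_pos (by linarith))
    · exact add_pos_of_pos_of_nonneg (expNegInvGlue.pos_of_pos (by linarith))
        (expNegInvGlue.nonneg _)
  set s : ℝ → ℝ := fun x => E (4 * x - 1) / (E (4 * x - 1) + E (3 - 4 * x)) with hs
  have hsymm : ∀ x, s (1 - x) = 1 - s x := by
    intro x
    have h := (hpos x).ne'
    have e1 : 4 * (1 - x) - 1 = 3 - 4 * x := by ring
    have e2 : 3 - 4 * (1 - x) = 4 * x - 1 := by ring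
    simp only [hs]
    rw [e1, e2, add_comm (E (3 - 4 * x)), eq_sub_iff_add_eq, ← add_div, add_comm (E (3 - 4 * x)),
      div_self h]
  have hsmooth : ContDiff ℝ ∞ s := by
    refine ContDiff.div ?_ ?_ fun x => (hpos x).ne'
    · exact hsm.comp (by fun_prop)
    · exact (hsm.comp (by fun_prop)).add (hsm.comp (by fun_prop))
  have hE1 : HasDerivAt E (E 1) 1 := by
    have h1 : HasDerivAt (fun y : ℝ => Real.exp (-y⁻¹)) (Real.exp (-1)) 1 := by
      have h := ((hasDerivAt_inv (one_ne_zero (α := ℝ))).neg).exp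
      simpa using h
    have h2 : E 1 = Real.exp (-1) := by simp [hE, expNegInvGlue]
    rw [h2]
    refine h1.congr_of_eventuallyEq ?_
    filter_upwards [lt_mem_nhds (zero_lt_one (α := ℝ))] with y hy
    simp [hE, expNegInvGlue, not_le.2 hy]
  have hEpos : 0 < E 1 := expNegInvGlue.pos_of_pos one_pos
  refine ⟨s, hsmooth, ?_, ?_, ?_, ?_, ?_, ?_⟩
  · intro x hx
    have : E (4 * x - 1) = 0 := expNegInvGlue.zero_of_nonpos (by linarith [hx.2])
    simp [hs, this]
  · intro x _ y _ hxy
    have h1 : E (4 * x - 1) ≤ E (4 * y - 1) := expNegInvGlue.monotone (by linarith)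
    have h2 : E (3 - 4 * y) ≤ E (3 - 4 * x) := expNegInvGlue.monotone (by linarith)
    simp only [hs]
    rw [div_le_div_iff₀ (hpos x) (hpos y)]
    nlinarith [mul_le_mul h1 h2 (expNegInvGlue.nonneg _) (expNegInvGlue.nonneg _)]
  · have := hsymm (1 / 2)
    norm_num at this ⊢
    linarith
  · have h1 : HasDerivAt (fun x : ℝ => E (4 * x - 1)) (E 1 * 4) (1 / 2) := by
      have hg : HasDerivAt (fun x : ℝ => 4 * x - 1) 4 (1 / 2) := by
        simpa using ((hasDerivAt_id (1 / 2 : ℝ)).const_mul 4).sub_const 1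
      exact HasDerivAt.comp (1 / 2 : ℝ) (by norm_num; exact hE1) hg
    have h2 : HasDerivAt (fun x : ℝ => E (3 - 4 * x)) (E 1 * (-4)) (1 / 2) := by
      have hg : HasDerivAt (fun x : ℝ => 3 - 4 * x) (-4) (1 / 2) := by
        simpa using ((hasDerivAt_id (1 / 2 : ℝ)).const_mul 4).const_sub 3
      exact HasDerivAt.comp (1 / 2 : ℝ) (by norm_num; exact hE1) hg
    have h := (h1.fun_div (h1.fun_add h2) (hpos _).ne').deriv
    rw [show deriv s (1 / 2) = _ from h]
    norm_num
    field_simp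
    norm_num
  · have h := congrFun (iteratedDeriv_comp_const_sub 2 s 1) (1 / 2)
    have h' : (fun z => s (1 - z)) = fun z => 1 + -s z := by
      funext z; rw [hsymm]; ring
    rw [h', iteratedDeriv_const_add (by norm_num), iteratedDeriv_fun_neg] at h
    norm_num at h
    norm_num
    linarith
  · intro x hx
    have : E (3 - 4 * x) = 0 := expNegInvGlue.zero_of_nonpos (by linarith [hx.1])
    have h := (hpos x).ne'
    simp only [this, add_zero] at h
    simp [hs, this, h]

/-- The profile `s`, changed to the constants `0` and `1` to the left and to the right of `[0, 1]`.
Nothing is assumed about `s` outside `[0, 1]`. -/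
noncomputable def clampedProfile (s : ℝ → ℝ) (x : ℝ) : ℝ := s (max 0 (min x 1))

theorem clampedProfile_of_mem (s : ℝ → ℝ) {x : ℝ} (hx : x ∈ Icc (0 : ℝ) 1) :
    clampedProfile s x = s x := by
  rw [clampedProfile, min_eq_left hx.2, max_eq_right hx.1]

theorem clampedProfile_of_le {s : ℝ → ℝ} (hs : IsCutoffProfile s) {x : ℝ} (hx : x ≤ 1 / 4) :
    clampedProfile s x = 0 := by
  apply hs.eq_zero
  rw [min_eq_left (by linarith)]
  exact ⟨le_max_left _ _, max_le (by norm_num) hx⟩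

theorem clampedProfile_of_ge {s : ℝ → ℝ} (hs : IsCutoffProfile s) {x : ℝ} (hx : 3 / 4 ≤ x) :
    clampedProfile s x = 1 := by
  apply hs.eq_one
  rw [max_eq_right (le_min (by linarith) zero_le_one)]
  exact ⟨le_min hx (by norm_num), min_le_right _ _⟩

theorem clampedProfile_mem_Icc {s : ℝ → ℝ} (hs : IsCutoffProfile s) (x : ℝ) :
    clampedProfile s x ∈ Icc (0 : ℝ) 1 := by
  rcases le_or_gt x (1 / 4) with h | h
  · simp [clampedProfile_of_le hs h]
  rcases le_or_gt (3 / 4) x with h' | h'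
  · simp [clampedProfile_of_ge hs h']
  rw [clampedProfile_of_mem s ⟨by linarith, by linarith⟩]
  have hx : x ∈ Icc (1 / 4 : ℝ) (3 / 4) := ⟨h.le, h'.le⟩
  constructor
  · rw [← hs.eq_zero (1 / 4) (by norm_num)]
    exact hs.mono (by norm_num) hx h.le
  · rw [← hs.eq_one (3 / 4) (by norm_num)]
    exact hs.mono hx (by norm_num) h'.le

theorem contDiff_clampedProfile {s : ℝ → ℝ} (hs : IsCutoffProfile s) :
    ContDiff ℝ ∞ (clampedProfile s) := by
  rw [contDiff_iff_contDiffAt]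
  intro x
  rcases lt_or_ge x (1 / 4) with h | h
  · refine (contDiffAt_const (c := (0 : ℝ))).congr_of_eventuallyEq ?_
    filter_upwards [gt_mem_nhds h] with y hy using clampedProfile_of_le hs hy.le
  rcases lt_or_ge (3 / 4) x with h' | h'
  · refine (contDiffAt_const (c := (1 : ℝ))).congr_of_eventuallyEq ?_
    filter_upwards [lt_mem_nhds h'] with y hy using clampedProfile_of_ge hs hy.le
  · refine hs.smooth.contDiffAt.congr_of_eventuallyEq ?_
    filter_upwards [Icc_mem_nhds (show (0 : ℝ) < x by linarith) (show x < 1 by linarith)] with y hy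
      using clampedProfile_of_mem s hy

theorem contDiff_ofReal_clampedProfile {s : ℝ → ℝ} (hs : IsCutoffProfile s) :
    ContDiff ℝ ∞ (fun x => (clampedProfile s x : ℂ)) :=
  Complex.ofRealCLM.contDiff.comp (contDiff_clampedProfile hs)

theorem exists_bound_iteratedFDeriv_clampedProfile {s : ℝ → ℝ} (hs : IsCutoffProfile s) (k : ℕ) :
    ∃ C : ℝ, 1 ≤ C ∧ ∀ i ≤ k, ∀ x,
      ‖iteratedFDeriv ℝ i (fun x => (clampedProfile s x : ℂ)) x‖ ≤ C := by
  have hc : ∀ i : ℕ, ∀ c : ℂ, ‖c‖ ≤ 1 → ∀ x,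
      ‖iteratedFDeriv ℝ i (fun _ : ℝ => c) x‖ ≤ 1 := by
    intro i c hc x
    rcases eq_or_ne i 0 with rfl | hi
    · simpa using hc
    · simp [iteratedFDeriv_const_of_ne hi]
  have hb : ∀ i : ℕ, ∃ C : ℝ, ∀ x,
      ‖iteratedFDeriv ℝ i (fun x => (clampedProfile s x : ℂ)) x‖ ≤ C := by
    intro i
    have hcont : Continuous (iteratedFDeriv ℝ i (fun x => (clampedProfile s x : ℂ))) :=
      (contDiff_ofReal_clampedProfile hs).continuous_iteratedFDeriv (by exact_mod_cast le_top)
    obtain ⟨C, hC⟩ := (isCompact_Icc (a := (0 : ℝ)) (b := 1)).exists_bound_of_continuousOn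
      hcont.continuousOn
    refine ⟨max C 1, fun x => ?_⟩
    by_cases hx : x ∈ Icc (0 : ℝ) 1
    · exact (hC x hx).trans (le_max_left _ _)
    refine le_trans ?_ (le_max_right _ _)
    rcases lt_or_ge x 0 with h | h
    · have he : (fun x => (clampedProfile s x : ℂ)) =ᶠ[𝓝 x] fun _ => (0 : ℂ) := by
        filter_upwards [gt_mem_nhds h] with y hy
        simp [clampedProfile_of_le hs (show y ≤ 1 / 4 by linarith)]
      rw [(he.iteratedFDeriv ℝ i).self_of_nhds]
      exact hc i 0 (by simp) x
    · have h1 : 1 < x := by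
        by_contra h1
        exact hx ⟨h, not_lt.1 h1⟩
      have he : (fun x => (clampedProfile s x : ℂ)) =ᶠ[𝓝 x] fun _ => (1 : ℂ) := by
        filter_upwards [lt_mem_nhds h1] with y hy
        simp [clampedProfile_of_ge hs (show 3 / 4 ≤ y by linarith)]
      rw [(he.iteratedFDeriv ℝ i).self_of_nhds]
      exact hc i 1 (by simp) x
  choose C hC using hb
  refine ⟨1 + ∑ i ∈ Finset.range (k + 1), C i, ?_, fun i hi x => (hC i x).trans ?_⟩
  · have : 0 ≤ ∑ i ∈ Finset.range (k + 1), C i :=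
      Finset.sum_nonneg fun i _ => (norm_nonneg _).trans (hC i 0)
    linarith
  · have := Finset.single_le_sum (f := C) (s := Finset.range (k + 1))
      (fun i _ => (norm_nonneg _).trans (hC i 0)) (Finset.mem_range.2 (Nat.lt_succ_of_le hi))
    linarith

theorem exists_lipschitzWith_clampedProfile {s : ℝ → ℝ} (hs : IsCutoffProfile s) :
    ∃ M : NNReal, LipschitzWith M (fun x => (clampedProfile s x : ℂ)) := by
  obtain ⟨C, hC1, hC⟩ := exists_bound_iteratedFDeriv_clampedProfile hs 1
  refine ⟨⟨C, by linarith⟩, lipschitzWith_of_nnnorm_deriv_le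
    ((contDiff_ofReal_clampedProfile hs).differentiable (by simp)) fun x => ?_⟩
  have := hC 1 le_rfl x
  rw [norm_iteratedFDeriv_eq_norm_iteratedDeriv, iteratedDeriv_one] at this
  exact this

/-! ### Bounds on higher derivatives -/

/-- The derivatives of `f` of order `j ≤ k` are bounded by `A * B ^ j` on `S`.  In this form Leibniz'
rule becomes the binomial formula: amplitudes `A` multiply and rates `B` add. -/
def DerivBound (k : ℕ) (S : Set ℂ) (A B : ℝ) (f : ℂ → ℂ) : Prop :=
  ∀ j ≤ k, ∀ x ∈ S, ‖iteratedFDeriv ℝ j f x‖ ≤ A * B ^ j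

theorem DerivBound.mul {k : ℕ} {S : Set ℂ} {A B A' B' : ℝ} {f g : ℂ → ℂ}
    (hf : DerivBound k S A B f) (hg : DerivBound k S A' B' g) (hfs : ContDiff ℝ ∞ f)
    (hgs : ContDiff ℝ ∞ g) : DerivBound k S (A * A') (B + B') (fun z => f z * g z) := by
  intro j hj x hx
  refine (norm_iteratedFDeriv_mul_le hfs hgs x (n := j) (by exact_mod_cast le_top)).trans ?_
  rw [add_pow, Finset.mul_sum]
  refine Finset.sum_le_sum fun i hi => ?_
  have hi' : i ≤ j := Nat.lt_succ_iff.1 (Finset.mem_range.1 hi)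
  have h1 := hf i (by omega) x hx
  have h2 := hg (j - i) (by omega) x hx
  calc (j.choose i : ℝ) * ‖iteratedFDeriv ℝ i f x‖ * ‖iteratedFDeriv ℝ (j - i) g x‖
      = j.choose i * (‖iteratedFDeriv ℝ i f x‖ * ‖iteratedFDeriv ℝ (j - i) g x‖) := by ring
    _ ≤ j.choose i * ((A * B ^ i) * (A' * B' ^ (j - i))) := by
        gcongr
        exact (norm_nonneg _).trans h1
    _ = A * A' * (B ^ i * B' ^ (j - i) * j.choose i) := by ring

theorem DerivBound.const (k : ℕ) (S : Set ℂ) (c : ℂ) : DerivBound k S ‖c‖ 0 (fun _ => c) := by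
  intro j _ x _
  rcases eq_or_ne j 0 with rfl | hj
  · simp
  · simp [iteratedFDeriv_const_of_ne hj, hj]

theorem DerivBound.id (k : ℕ) {S : Set ℂ} {R : ℝ} (hR : 0 < R) (hS : ∀ x ∈ S, ‖x‖ ≤ R) :
    DerivBound k S R R⁻¹ (fun z => z) := by
  intro j _ x hx
  have hd : (fderiv ℝ fun z : ℂ => z) = fun _ => ContinuousLinearMap.id ℝ ℂ := by
    funext y; exact fderiv_fun_id
  rcases j with _ | _ | j
  · simpa using hS x hx
  · rw [← norm_iteratedFDeriv_fderiv, hd]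
    simp [hR.ne']
  · rw [← norm_iteratedFDeriv_fderiv, hd, iteratedFDeriv_const_of_ne (by omega)]
    simp only [Pi.zero_apply, norm_zero]
    positivity

theorem DerivBound.pow (k : ℕ) {S : Set ℂ} {R : ℝ} (hR : 0 < R) (hS : ∀ x ∈ S, ‖x‖ ≤ R) (p : ℕ) :
    DerivBound k S (R ^ p) (p * R⁻¹) (fun z => z ^ p) := by
  induction p with
  | zero => simpa using DerivBound.const k S 1
  | succ p ih =>
    have := ih.mul (DerivBound.id k hR hS) (by fun_prop) (by fun_prop)
    have e : (p : ℝ) * R⁻¹ + R⁻¹ = ((p + 1 : ℕ) : ℝ) * R⁻¹ := by push_cast; ring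
    simpa only [e, ← pow_succ] using this

/-- The norm is homogeneous of degree one, so its `i`-th derivative is homogeneous of degree
`1 - i`, and is bounded on the unit circle by compactness. -/
theorem exists_bound_iteratedFDeriv_norm (k : ℕ) :
    ∃ K : ℝ, 1 ≤ K ∧ ∀ i ≤ k, ∀ x : ℂ, x ≠ 0 →
      ‖iteratedFDeriv ℝ i (fun z : ℂ => ‖z‖) x‖ ≤ K * (‖x‖ * ‖x‖⁻¹ ^ i) := by
  have hb : ∀ i : ℕ, ∃ C : ℝ, ∀ x ∈ sphere (0 : ℂ) 1,
      ‖iteratedFDeriv ℝ i (fun z : ℂ => ‖z‖) x‖ ≤ C := by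
    intro i
    refine (isCompact_sphere (0 : ℂ) 1).exists_bound_of_continuousOn fun x hx => ?_
    have hx0 : x ≠ 0 := by
      rintro rfl
      simp at hx
    exact ((contDiffAt_norm (𝕜 := ℝ) (n := i) hx0).continuousAt_iteratedFDeriv
      le_rfl).continuousWithinAt
  choose C hC using hb
  have hC0 : ∀ i, 0 ≤ C i := fun i => (norm_nonneg _).trans (hC i 1 (by simp))
  refine ⟨1 + ∑ i ∈ Finset.range (k + 1), C i, ?_, fun i hi x hx => ?_⟩
  · linarith [Finset.sum_nonneg (s := Finset.range (k + 1)) fun i _ => hC0 i]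
  have hc : (‖x‖⁻¹ : ℝ) ≠ 0 := inv_ne_zero (norm_ne_zero_iff.2 hx)
  set g : ℂ ≃L[ℝ] ℂ := ContinuousLinearEquiv.smulLeft (Units.mk0 (‖x‖⁻¹) hc) with hg
  have hgx : ∀ y, g y = ‖x‖⁻¹ • y := fun y => rfl
  have hfun : (fun z : ℂ => ‖z‖) = ‖x‖ • ((fun z : ℂ => ‖z‖) ∘ g) := by
    funext z
    simp only [Pi.smul_apply, Function.comp_apply, hgx, norm_smul, norm_inv, norm_norm,
      smul_eq_mul]
    field_simp [norm_ne_zero_iff.2 hx]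
  have hgx0 : g x ≠ 0 := by
    rw [hgx]
    exact smul_ne_zero hc hx
  have hsph : g x ∈ sphere (0 : ℂ) 1 := by
    rw [mem_sphere_zero_iff_norm, hgx, norm_smul, norm_inv, norm_norm,
      inv_mul_cancel₀ (norm_ne_zero_iff.2 hx)]
  have hsm : ContDiffAt ℝ i ((fun z : ℂ => ‖z‖) ∘ g) x :=
    (contDiffAt_norm ℝ hgx0).comp x g.contDiff.contDiffAt
  have hcomp := g.iteratedFDerivWithin_comp_right (fun z : ℂ => ‖z‖) uniqueDiffOn_univ
    (mem_univ (g x)) i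
  rw [preimage_univ, iteratedFDerivWithin_univ, iteratedFDerivWithin_univ] at hcomp
  rw [hfun, iteratedFDeriv_const_smul_apply hsm, hcomp, norm_smul, norm_norm]
  have hgn : ‖(g : ℂ →L[ℝ] ℂ)‖ ≤ ‖x‖⁻¹ :=
    ContinuousLinearMap.opNorm_le_bound _ (by positivity) fun y => by
      simp [hgx]
  have h1 := ContinuousMultilinearMap.norm_compContinuousLinearMap_le
    (iteratedFDeriv ℝ i (fun z : ℂ => ‖z‖) (g x)) (fun _ : Fin i => (g : ℂ →L[ℝ] ℂ))
  rw [Finset.prod_const, Finset.card_univ, Fintype.card_fin] at h1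
  have h2 : C i ≤ 1 + ∑ i ∈ Finset.range (k + 1), C i := by
    linarith [Finset.single_le_sum (f := C) (s := Finset.range (k + 1))
      (fun i _ => hC0 i) (Finset.mem_range.2 (Nat.lt_succ_of_le hi))]
  calc ‖x‖ * _ ≤ ‖x‖ * (C i * ‖x‖⁻¹ ^ i) := by
        gcongr
        refine h1.trans ?_
        gcongr
        · exact hC0 i
        · exact hC i _ hsph
    _ = C i * (‖x‖ * ‖x‖⁻¹ ^ i) := by ring
    _ ≤ _ := by gcongr

/-- The radial cutoff `σ((|z| - a) / δ)` built from a cutoff profile. -/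
noncomputable def radialCutoff (s : ℝ → ℝ) (a δ : ℝ) (z : ℂ) : ℂ :=
  (clampedProfile s ((‖z‖ - a) / δ) : ℂ)

theorem contDiff_radialCutoff {s : ℝ → ℝ} (hs : IsCutoffProfile s) {a δ : ℝ} (ha : 0 < a)
    (hδ : 0 < δ) : ContDiff ℝ ∞ (radialCutoff s a δ) := by
  rw [contDiff_iff_contDiffAt]
  intro z
  rcases eq_or_ne z 0 with rfl | hz
  · refine (contDiffAt_const (c := (0 : ℂ))).congr_of_eventuallyEq ?_
    filter_upwards [ball_mem_nhds (0 : ℂ) ha] with w hw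
    rw [mem_ball_zero_iff] at hw
    have : (‖w‖ - a) / δ ≤ 0 := div_nonpos_of_nonpos_of_nonneg (by linarith) hδ.le
    simp [radialCutoff, clampedProfile_of_le hs (this.trans (by norm_num))]
  · refine (contDiff_ofReal_clampedProfile hs).contDiffAt.comp z ?_
    exact ((contDiffAt_norm ℝ hz).sub contDiffAt_const).div_const δ

theorem norm_radialCutoff_le {s : ℝ → ℝ} (hs : IsCutoffProfile s) (a δ : ℝ) (z : ℂ) :
    ‖radialCutoff s a δ z‖ ≤ 1 ∧ ‖1 - radialCutoff s a δ z‖ ≤ 1 := by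
  have h := clampedProfile_mem_Icc hs ((‖z‖ - a) / δ)
  rw [radialCutoff, ← Complex.ofReal_one, ← Complex.ofReal_sub, Complex.norm_real,
    Complex.norm_real, Real.norm_eq_abs, Real.norm_eq_abs, abs_le, abs_le]
  refine ⟨⟨?_, ?_⟩, ?_, ?_⟩ <;> linarith [h.1, h.2]

/-- The derivatives of a radial cutoff of width `δ` on `{|z| ≥ a'}` are controlled by powers of
`1 / δ` and `1 / a'`, through the Faà di Bruno formula. -/
theorem exists_derivBound_radialCutoff {s : ℝ → ℝ} (hs : IsCutoffProfile s) (k : ℕ) :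
    ∃ C : ℝ, 1 ≤ C ∧ ∀ a δ L : ℝ, 0 < a → 0 < δ → 1 ≤ L → δ⁻¹ ≤ L → ∀ S : Set ℂ,
      (∀ x ∈ S, x ≠ 0 ∧ ‖x‖⁻¹ ≤ L) →
      DerivBound k S C (C * L) (radialCutoff s a δ) ∧
      DerivBound k S C (C * L) (fun z => 1 - radialCutoff s a δ z) := by
  obtain ⟨C, hC1, hC⟩ := exists_bound_iteratedFDeriv_clampedProfile hs k
  obtain ⟨K, hK1, hK⟩ := exists_bound_iteratedFDeriv_norm k
  have hf1 : (1 : ℝ) ≤ k.factorial := by exact_mod_cast Nat.one_le_iff_ne_zero.2 k.factorial_ne_zero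
  have hfC : 1 ≤ k.factorial * C := one_le_mul_of_one_le_of_one_le hf1 hC1
  have hM1 : 1 ≤ k.factorial * C * K := one_le_mul_of_one_le_of_one_le hfC hK1
  have hCM : k.factorial * C ≤ k.factorial * C * K := le_mul_of_one_le_right (by linarith) hK1
  have hKM : K ≤ k.factorial * C * K := le_mul_of_one_le_left (by linarith) hfC
  have hmain : ∀ a δ L : ℝ, 0 < a → 0 < δ → 1 ≤ L → δ⁻¹ ≤ L → ∀ S : Set ℂ,
      (∀ x ∈ S, x ≠ 0 ∧ ‖x‖⁻¹ ≤ L) →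
      DerivBound k S (k.factorial * C * K) (k.factorial * C * K * L) (radialCutoff s a δ) := by
    intro a δ L ha hδ hL1 hL S hS j hj x hx
    obtain ⟨hx0, hxL⟩ := hS x hx
    have hopen : IsOpen ({0}ᶜ : Set ℂ) := isOpen_compl_singleton
    have hxm : x ∈ ({0}ᶜ : Set ℂ) := hx0
    set h : ℂ → ℝ := fun z => (‖z‖ - a) / δ with hh
    have hhs : ContDiffOn ℝ ∞ h {0}ᶜ := fun z hz =>
      (((contDiffAt_norm ℝ hz).sub contDiffAt_const).div_const δ).contDiffWithinAt
    have hhb : ∀ i : ℕ, 1 ≤ i → i ≤ j → ‖iteratedFDerivWithin ℝ i h {0}ᶜ x‖ ≤ (K * L) ^ i := by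
      intro i hi1 hij
      rw [iteratedFDerivWithin_of_isOpen i hopen hxm]
      have hfun : h = δ⁻¹ • ((fun z : ℂ => ‖z‖) - fun _ => a) := by
        funext z; simp [hh]; ring
      have hsm : ContDiffAt ℝ i (fun z : ℂ => ‖z‖) x := contDiffAt_norm ℝ hx0
      have hsm' : ContDiffAt ℝ i ((fun z : ℂ => ‖z‖) - fun _ => a) x := hsm.sub contDiffAt_const
      rw [hfun, iteratedFDeriv_const_smul_apply hsm',
        iteratedFDeriv_sub_apply hsm contDiffAt_const, iteratedFDeriv_const_of_ne (by omega),
        Pi.zero_apply, sub_zero, norm_smul, Real.norm_of_nonneg (inv_nonneg.2 hδ.le)]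
      obtain ⟨i, rfl⟩ : ∃ i', i = i' + 1 := ⟨i - 1, by omega⟩
      have hxn : ‖x‖ ≠ 0 := norm_ne_zero_iff.2 hx0
      calc δ⁻¹ * ‖iteratedFDeriv ℝ (i + 1) (fun z : ℂ => ‖z‖) x‖
          ≤ L * (K * (‖x‖ * ‖x‖⁻¹ ^ (i + 1))) := by
            gcongr
            exact hK _ (hij.trans hj) x hx0
        _ = L * (K * ‖x‖⁻¹ ^ i) := by
            rw [pow_succ']
            field_simp
        _ ≤ L * (K ^ (i + 1) * L ^ i) := by
            gcongr
            exact le_self_pow₀ hK1 (by omega)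
        _ = (K * L) ^ (i + 1) := by ring
    have hcomp := norm_iteratedFDerivWithin_comp_le (n := j) (t := univ) (x := x)
      (contDiff_ofReal_clampedProfile hs).contDiffOn hhs (by exact_mod_cast le_top)
      uniqueDiffOn_univ hopen.uniqueDiffOn (mapsTo_univ _ _) hxm (C := C) (D := K * L)
      (fun i hi => by
        rw [iteratedFDerivWithin_univ]
        exact hC i (hi.trans hj) _) hhb
    rw [iteratedFDerivWithin_of_isOpen j hopen hxm] at hcomp
    refine hcomp.trans ?_
    have hjk : (j.factorial : ℝ) ≤ k.factorial := by exact_mod_cast Nat.factorial_le hj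
    have h3 : (j.factorial : ℝ) * C ≤ k.factorial * C * K :=
      (mul_le_mul_of_nonneg_right hjk (by linarith)).trans hCM
    gcongr
  refine ⟨_, hM1, fun a δ L ha hδ hL1 hL S hS => ⟨hmain a δ L ha hδ hL1 hL S hS, ?_⟩⟩
  intro j hj x hx
  rcases eq_or_ne j 0 with rfl | hj0
  · rw [norm_iteratedFDeriv_zero, pow_zero, mul_one]
    exact (norm_radialCutoff_le hs a δ x).2.trans hM1
  · have hsm : ContDiffAt ℝ j (radialCutoff s a δ) x :=
      ((contDiff_radialCutoff hs ha hδ).of_le (by exact_mod_cast le_top)).contDiffAt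
    rw [show (fun z => 1 - radialCutoff s a δ z) = (fun _ => (1 : ℂ)) - radialCutoff s a δ from rfl,
      iteratedFDeriv_sub_apply contDiffAt_const hsm, iteratedFDeriv_const_of_ne hj0,
      Pi.zero_apply, zero_sub, norm_neg]
    exact hmain a δ L ha hδ hL1 hL S hS j hj x hx

/-! ### The radii and the coefficients -/

theorem log_natCast_pos {n : ℕ} (hn : 2 ≤ n) : 0 < Real.log (n : ℝ) :=
  Real.log_pos (by exact_mod_cast hn)

theorem logRadius_eq (n : ℕ) : logRadius n = (Real.log ((n + 1 : ℕ) : ℝ))⁻¹ := by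
  simp [logRadius]

theorem logRadius_pos {n : ℕ} (hn : 1 ≤ n) : 0 < logRadius n := by
  rw [logRadius_eq]
  exact inv_pos.2 (log_natCast_pos (by omega))

theorem logRadius_anti {m n : ℕ} (hm : 1 ≤ m) (hmn : m ≤ n) : logRadius n ≤ logRadius m := by
  rw [logRadius_eq, logRadius_eq]
  apply inv_anti₀ (log_natCast_pos (by omega))
  apply Real.log_le_log (by positivity)
  exact_mod_cast (by omega)

theorem logRadius_succ_lt {n : ℕ} (hn : 1 ≤ n) : logRadius (n + 1) < logRadius n := by
  rw [logRadius_eq, logRadius_eq]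
  apply inv_strictAnti₀ (log_natCast_pos (by omega))
  apply Real.log_lt_log (by positivity)
  exact_mod_cast (by omega)

theorem log_natCast_succ_le (n : ℕ) : Real.log ((n + 1 : ℕ) : ℝ) ≤ n := by
  have := Real.log_le_sub_one_of_pos (show (0 : ℝ) < ((n + 1 : ℕ) : ℝ) by positivity)
  push_cast at this ⊢
  linarith

theorem inv_logRadius_sub_le {n : ℕ} (hn : 1 ≤ n) :
    (logRadius n - logRadius (n + 1))⁻¹ ≤
      (n + 2) * (Real.log ((n + 1 : ℕ) : ℝ) * Real.log ((n + 2 : ℕ) : ℝ)) := by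
  have h1 := log_natCast_pos (n := n + 1) (by omega)
  have h2 := log_natCast_pos (n := n + 2) (by omega)
  have hd : 1 / ((n : ℝ) + 2) ≤ Real.log ((n + 2 : ℕ) : ℝ) - Real.log ((n + 1 : ℕ) : ℝ) := by
    have := Real.one_sub_inv_le_log_of_pos
      (show (0 : ℝ) < ((n + 2 : ℕ) : ℝ) / ((n + 1 : ℕ) : ℝ) by positivity)
    rw [Real.log_div (by positivity) (by positivity)] at this
    refine le_trans (le_of_eq ?_) this
    push_cast
    field_simp
    ring
  have hd0 : 0 < 1 / ((n : ℝ) + 2) := by positivity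
  rw [logRadius_eq, logRadius_eq, inv_sub_inv h1.ne' h2.ne', inv_div, div_le_iff₀ (by linarith)]
  have : (1 : ℝ) ≤ (n + 2) * (Real.log ((n + 2 : ℕ) : ℝ) - Real.log ((n + 1 : ℕ) : ℝ)) := by
    rw [div_le_iff₀ (by positivity)] at hd
    linarith
  nlinarith [mul_pos h1 h2]

/-- A polynomial bound for the reciprocal width of an annulus. -/
theorem inv_logRadius_sub_le_pow {n : ℕ} (hn : 1 ≤ n) :
    (logRadius n - logRadius (n + 1))⁻¹ ≤ ((n : ℝ) + 2) ^ 3 := by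
  refine (inv_logRadius_sub_le hn).trans ?_
  have h1 := (log_natCast_succ_le n)
  have h2 := (log_natCast_succ_le (n + 1))
  have h3 := log_natCast_pos (n := n + 1) (by omega)
  have h4 := log_natCast_pos (n := n + 2) (by omega)
  push_cast at h1 h2 h3 h4 ⊢
  rw [show (n : ℝ) + 1 + 1 = n + 2 by ring] at h2
  calc ((n : ℝ) + 2) * (Real.log (n + 1) * Real.log (n + 2)) ≤ (n + 2) * ((n + 2) * (n + 2)) := by
        gcongr <;> linarith
    _ = _ := by ring

/-- For `n = 0` both sides vanish, because `logRadius 0 = 1 / 0 = 0`. -/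
theorem inv_logRadius_le {n : ℕ} : (logRadius n)⁻¹ ≤ n := by
  rw [logRadius_eq, inv_inv]
  exact log_natCast_succ_le n

/-- The index is the one with `n + 1 ≤ exp (1 / |z|) < n + 2`. -/
theorem exists_mem_annulus {z : ℂ} (hz : z ≠ 0) (h1 : ‖z‖ ≤ logRadius 1) :
    ∃ n, 1 ≤ n ∧ z ∈ annulus logRadius n := by
  have hz0 : 0 < ‖z‖ := norm_pos_iff.2 hz
  have h2 : 2 ≤ Real.exp ‖z‖⁻¹ := by
    rw [← Real.log_le_iff_le_exp (by norm_num)]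
    rw [logRadius_eq] at h1
    have h2 := (le_inv_comm₀ hz0 (log_natCast_pos (n := 1 + 1) (by omega))).1 h1
    exact_mod_cast h2
  obtain ⟨n, hn⟩ : ∃ n, ⌊Real.exp ‖z‖⁻¹⌋₊ = n + 1 :=
    ⟨⌊Real.exp ‖z‖⁻¹⌋₊ - 1, by have := Nat.le_floor (n := 2) (by exact_mod_cast h2); omega⟩
  have hn1 : 1 ≤ n := by have := Nat.le_floor (n := 2) (by exact_mod_cast h2); omega
  refine ⟨n, hn1, ?_, ?_⟩
  · rw [logRadius_eq]
    refine inv_le_of_inv_le₀ hz0 ?_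
    rw [Real.le_log_iff_exp_le (by positivity)]
    have := Nat.lt_floor_add_one (Real.exp ‖z‖⁻¹)
    rw [hn] at this
    exact_mod_cast this.le
  · rw [logRadius_eq]
    refine (le_inv_comm₀ (log_natCast_pos (by omega)) hz0).1 ?_
    rw [Real.log_le_iff_le_exp (by positivity), ← hn]
    exact Nat.floor_le (by positivity)

theorem logCoeff_zero : logCoeff 0 = 1 := by simp [logCoeff]

theorem logCoeff_succ (n : ℕ) :
    logCoeff (n + 1) = logCoeff n * Real.log ((n + 3 : ℕ) : ℝ) ^ (2 * n) := by
  rcases n with _ | n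
  · simp [logCoeff]
  · have e1 : ((n + 1 + 1 : ℕ) : ℝ) + 2 = ((n + 1 + 3 : ℕ) : ℝ) := by push_cast; ring
    rw [logCoeff, Finset.prod_Icc_succ_top (by omega), mul_pow, ← logCoeff, ← pow_mul, e1,
      Nat.add_sub_cancel, mul_comm (n + 1) 2]

theorem logCoeff_pos (n : ℕ) : 0 < logCoeff n := by
  induction n with
  | zero => simp [logCoeff_zero]
  | succ n ih =>
    rw [logCoeff_succ]
    exact mul_pos ih (pow_pos (log_natCast_pos (by omega)) _)

theorem logCoeff_le (n : ℕ) : logCoeff n ≤ Real.log ((n + 2 : ℕ) : ℝ) ^ (n * (n - 1)) := by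
  induction n with
  | zero => simp [logCoeff_zero]
  | succ n ih =>
    rw [logCoeff_succ]
    have h := log_natCast_pos (n := n + 2) (by omega)
    have h' : Real.log ((n + 2 : ℕ) : ℝ) ≤ Real.log ((n + 3 : ℕ) : ℝ) :=
      Real.log_le_log (by positivity) (by exact_mod_cast (by omega))
    have e : (n + 1) * (n + 1 - 1) = n * (n - 1) + 2 * n := by
      rcases n with _ | n
      · rfl
      · simp only [Nat.add_sub_cancel]; ring
    rw [e, pow_add]
    have h0 := h.le
    gcongr
    exact ih.trans (pow_le_pow_left₀ h0 h' _)

/-- Each coefficient exceeds the previous one by just the power of `ln (n + 2)` that makes the two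
monomials comparable on the inner circle of the annulus. -/
theorem logCoeff_mul_pow_le {n : ℕ} {ρ : ℝ} (hρ : logRadius (n + 2) ≤ ρ) :
    logCoeff n * ρ ^ n ^ 2 ≤ logCoeff (n + 1) * ρ ^ ((n + 1) ^ 2 - 1) := by
  have hρ0 : 0 < ρ := (logRadius_pos (by omega)).trans_le hρ
  have hL := log_natCast_pos (n := n + 3) (by omega)
  rw [logRadius_eq] at hρ
  have h1 : 1 ≤ Real.log ((n + 3 : ℕ) : ℝ) * ρ := by
    rw [inv_le_iff_one_le_mul₀ hL] at hρ
    linarith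
  have e : (n + 1) ^ 2 - 1 = n ^ 2 + 2 * n := by
    rw [show (n + 1) ^ 2 = n ^ 2 + 2 * n + 1 by ring]
    rfl
  rw [logCoeff_succ, e]
  have hF := logCoeff_pos n
  calc logCoeff n * ρ ^ n ^ 2 = logCoeff n * ρ ^ n ^ 2 * 1 := by ring
    _ ≤ logCoeff n * ρ ^ n ^ 2 * (Real.log ((n + 3 : ℕ) : ℝ) * ρ) ^ (2 * n) := by
        gcongr
        exact one_le_pow₀ h1
    _ = _ := by ring

theorem log_div_log_pow_le (n : ℕ) (hn : 1 ≤ n) :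
    (Real.log ((n + 3 : ℕ) : ℝ) / Real.log ((n + 1 : ℕ) : ℝ)) ^ (2 * n) ≤
      Real.exp (4 / Real.log 2) := by
  have hL := log_natCast_pos (n := n + 1) (by omega)
  have hL2 : 0 < Real.log 2 := Real.log_pos (by norm_num)
  have hL3 := log_natCast_pos (n := n + 3) (by omega)
  have hLL : Real.log 2 ≤ Real.log ((n + 1 : ℕ) : ℝ) :=
    Real.log_le_log (by norm_num) (by exact_mod_cast (by omega))
  have hn0 : (0 : ℝ) < n := by exact_mod_cast hn
  have h1 : Real.log ((n + 3 : ℕ) : ℝ) - Real.log ((n + 1 : ℕ) : ℝ) ≤ 2 / n := by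
    rw [← Real.log_div (by positivity) (by positivity)]
    refine (Real.log_le_sub_one_of_pos (by positivity)).trans ?_
    rw [div_sub_one (by positivity), div_le_div_iff₀ (by positivity) hn0]
    push_cast
    nlinarith
  have h2 : Real.log ((n + 3 : ℕ) : ℝ) / Real.log ((n + 1 : ℕ) : ℝ) ≤
      Real.exp (2 / (n * Real.log 2)) := by
    refine le_trans ?_ (Real.add_one_le_exp _)
    rw [div_le_iff₀ hL, add_mul, one_mul]
    have : 2 / n ≤ 2 / (n * Real.log 2) * Real.log ((n + 1 : ℕ) : ℝ) := by
      rw [div_mul_eq_mul_div, div_le_div_iff₀ hn0 (by positivity)]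
      nlinarith
    linarith
  calc _ ≤ Real.exp (2 / (n * Real.log 2)) ^ (2 * n) := by gcongr
    _ = Real.exp (4 / Real.log 2) := by
        rw [← Real.exp_nat_mul]
        congr 1
        push_cast
        field_simp
        norm_num

theorem exists_logCoeff_succ_mul_pow_le : ∃ C : ℝ, 0 < C ∧ ∀ n : ℕ, 1 ≤ n → ∀ ρ : ℝ, 0 ≤ ρ →
    ρ ≤ logRadius n →
      logCoeff (n + 1) * ρ ^ (n + 1) ^ 2 ≤ C * (logCoeff n * ρ ^ (n ^ 2 - 1)) := by
  have hr1 := logRadius_pos (n := 1) le_rfl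
  refine ⟨Real.exp (4 / Real.log 2) * logRadius 1 ^ 2, by positivity, fun n hn ρ hρ0 hρ => ?_⟩
  have hF := logCoeff_pos n
  have hL3 := log_natCast_pos (n := n + 3) (by omega)
  have e : (n + 1) ^ 2 = (n ^ 2 - 1) + 2 * n + 2 := by
    have : 1 ≤ n ^ 2 := Nat.one_le_pow _ _ hn
    rw [show (n + 1) ^ 2 = n ^ 2 + 2 * n + 1 by ring]
    omega
  have h1 : (Real.log ((n + 3 : ℕ) : ℝ) * ρ) ^ (2 * n) ≤ Real.exp (4 / Real.log 2) := by
    refine le_trans ?_ (log_div_log_pow_le n hn)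
    rw [div_eq_mul_inv, ← logRadius_eq]
    gcongr
  have h2 : ρ ^ 2 ≤ logRadius 1 ^ 2 := by
    gcongr
    exact hρ.trans (logRadius_anti le_rfl hn)
  rw [logCoeff_succ, e]
  calc _ = (Real.log ((n + 3 : ℕ) : ℝ) * ρ) ^ (2 * n) * ρ ^ 2 * (logCoeff n * ρ ^ (n ^ 2 - 1)) := by
        ring
    _ ≤ _ := by gcongr

/-- The size of the `n`-th monomial on the support of its cutoff decays exponentially, because the
quotient `ln (n + 2) / ln n` tends to `1` fast enough and `ln ln n` tends to infinity. -/
theorem eventually_logCoeff_mul_pow_le :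
    ∀ᶠ n : ℕ in atTop, logCoeff n * logRadius (n - 1) ^ n ^ 2 ≤ Real.exp (-(n : ℝ)) := by
  have hlog : Tendsto (fun n : ℕ => Real.log (n : ℝ)) atTop atTop :=
    Real.tendsto_log_atTop.comp tendsto_natCast_atTop_atTop
  -- The quotient of logarithms contributes at most `exp (2 * n)`, so `ln n ≥ exp 3` leaves a factor
  -- `exp (-n)`.
  filter_upwards [hlog.eventually_ge_atTop (Real.exp 3), eventually_ge_atTop 2] with n hn hn2
  have hn0 : (0 : ℝ) < n := by positivity
  have hL := log_natCast_pos hn2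
  have hL1 : 1 ≤ Real.log (n : ℝ) := by linarith [Real.add_one_le_exp 3]
  have hL2 := log_natCast_pos (n := n + 2) (by omega)
  have h1 : Real.log ((n + 2 : ℕ) : ℝ) / Real.log (n : ℝ) ≤ Real.exp (2 / n) := by
    refine le_trans ?_ (Real.add_one_le_exp _)
    have : Real.log ((n + 2 : ℕ) : ℝ) - Real.log (n : ℝ) ≤ 2 / n := by
      rw [← Real.log_div (by positivity) (by positivity)]
      refine (Real.log_le_sub_one_of_pos (by positivity)).trans ?_
      rw [div_sub_one (by positivity)]
      push_cast
      simp
    rw [div_le_iff₀ hL, add_mul, one_mul]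
    have : 2 / n ≤ 2 / n * Real.log (n : ℝ) := le_mul_of_one_le_right (by positivity) hL1
    linarith
  have e : n ^ 2 = n * (n - 1) + n := by
    obtain ⟨m, rfl⟩ : ∃ m, n = m + 1 := ⟨n - 1, by omega⟩
    simp only [Nat.add_sub_cancel]; ring
  have hr : logRadius (n - 1) = (Real.log (n : ℝ))⁻¹ := by
    rw [logRadius_eq, Nat.sub_add_cancel (by omega)]
  have h3 : (Real.log (n : ℝ))⁻¹ ≤ Real.exp (-3) := by
    rw [Real.exp_neg]
    exact inv_anti₀ (Real.exp_pos _) hn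
  rw [hr]
  calc logCoeff n * (Real.log (n : ℝ))⁻¹ ^ n ^ 2
      ≤ Real.log ((n + 2 : ℕ) : ℝ) ^ (n * (n - 1)) * (Real.log (n : ℝ))⁻¹ ^ n ^ 2 := by
        gcongr
        exact logCoeff_le n
    _ = (Real.log ((n + 2 : ℕ) : ℝ) / Real.log (n : ℝ)) ^ (n * (n - 1)) *
          (Real.log (n : ℝ))⁻¹ ^ n := by
        rw [e, pow_add, div_eq_mul_inv, mul_pow]; ring
    _ ≤ Real.exp (2 / n) ^ (n * (n - 1)) * Real.exp (-3) ^ n := by gcongr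
    _ ≤ Real.exp (2 / n) ^ (n * n) * Real.exp (-3) ^ n := by
        gcongr
        · exact Real.one_le_exp (by positivity)
        · omega
    _ = Real.exp (-(n : ℝ)) := by
        rw [← Real.exp_nat_mul, ← Real.exp_nat_mul, ← Real.exp_add]
        congr 1
        push_cast
        field_simp
        norm_num

theorem exists_logCoeff_mul_pow_le : ∃ C : ℝ, 0 < C ∧ ∀ n : ℕ, 1 ≤ n → ∀ ρ : ℝ, 0 ≤ ρ →
    ρ ≤ logRadius n → logCoeff n * ρ ^ n ^ 2 ≤ C * Real.exp (-(n : ℝ)) := by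
  have hO : (fun n : ℕ => logCoeff n * logRadius n ^ n ^ 2) =O[atTop]
      fun n : ℕ => Real.exp (-(n : ℝ)) := by
    refine Asymptotics.IsBigO.of_bound 1 ?_
    filter_upwards [eventually_logCoeff_mul_pow_le, eventually_ge_atTop 2] with n hn hn2
    have hr := logRadius_pos (n := n) (by omega)
    have hF := logCoeff_pos n
    rw [Real.norm_of_nonneg (by positivity), Real.norm_of_nonneg (by positivity), one_mul]
    refine le_trans ?_ hn
    gcongr
    exact logRadius_anti (by omega) (by omega)
  obtain ⟨C, hC0, hC⟩ := Asymptotics.bound_of_isBigO_nat_atTop hO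
  refine ⟨C, hC0, fun n hn ρ hρ0 hρ => ?_⟩
  have hF := logCoeff_pos n
  have h := hC (x := n) (Real.exp_pos _).ne'
  rw [Real.norm_of_nonneg (Real.exp_pos _).le] at h
  refine le_trans ?_ ((le_abs_self _).trans h)
  gcongr

/-! ### A smooth extension of the map -/

/-- The cutoff of the `n`-th annulus, extended by constants across its inner and outer circle.  The
value `0` for `n = 0` encodes that there is no annulus outside the first one. -/
noncomputable def logCutoff (s : ℝ → ℝ) (n : ℕ) : ℂ → ℂ :=
  if n = 0 then 0 else radialCutoff s (logRadius (n + 1)) (logRadius n - logRadius (n + 1))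

/-- The `n`-th monomial, cut off to the `n`-th annulus and its two neighbours.  For `n = 0` and
`n = 1` the truncated subtraction gives `logCutoff s 0 = 0`, so that there is no outer cutoff. -/
noncomputable def cutoffMonomial (s : ℝ → ℝ) (n : ℕ) (z : ℂ) : ℂ :=
  logCutoff s (n + 1) z * (1 - logCutoff s (n - 1) z) *
    powerPart (fun n => n ^ 2) logCoeff n z

/-- A smooth map of the whole plane that equals `logMap s` on the disk of radius `logRadius 1`: the
sum of the cut off monomials, those of even index in the first component and those of odd index in
the second. -/
noncomputable def smoothLogMap (s : ℝ → ℝ) (z : ℂ) : EuclideanSpace ℂ (Fin 2) :=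
  WithLp.toLp 2 fun i => ∑' n : ℕ, if n % 2 = (i : ℕ) then cutoffMonomial s n z else 0

theorem logCutoff_of_pos (s : ℝ → ℝ) {n : ℕ} (hn : 1 ≤ n) :
    logCutoff s n = radialCutoff s (logRadius (n + 1)) (logRadius n - logRadius (n + 1)) :=
  if_neg (by omega)

theorem logCutoff_zero (s : ℝ → ℝ) (z : ℂ) : logCutoff s 0 z = 0 := by
  simp [logCutoff]

theorem contDiff_logCutoff {s : ℝ → ℝ} (hs : IsCutoffProfile s) (n : ℕ) :
    ContDiff ℝ ∞ (logCutoff s n) := by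
  rcases Nat.eq_zero_or_pos n with rfl | hn
  · rw [funext (logCutoff_zero s)]
    exact contDiff_const
  · rw [logCutoff_of_pos s hn]
    exact contDiff_radialCutoff hs (logRadius_pos (by omega)) (sub_pos.2 (logRadius_succ_lt hn))

theorem logCutoff_eq_zero {s : ℝ → ℝ} (hs : IsCutoffProfile s) {n : ℕ} {z : ℂ}
    (hz : 4 * ‖z‖ ≤ 3 * logRadius (n + 1) + logRadius n) : logCutoff s n z = 0 := by
  rcases Nat.eq_zero_or_pos n with rfl | hn
  · exact logCutoff_zero s z
  rw [logCutoff_of_pos s hn, radialCutoff, clampedProfile_of_le hs, Complex.ofReal_zero]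
  rw [div_le_iff₀ (sub_pos.2 (logRadius_succ_lt hn))]
  linarith

theorem logCutoff_eq_one {s : ℝ → ℝ} (hs : IsCutoffProfile s) {n : ℕ} (hn : 1 ≤ n) {z : ℂ}
    (hz : logRadius (n + 1) + 3 * logRadius n ≤ 4 * ‖z‖) : logCutoff s n z = 1 := by
  rw [logCutoff_of_pos s hn, radialCutoff, clampedProfile_of_ge hs, Complex.ofReal_one]
  rw [le_div_iff₀ (sub_pos.2 (logRadius_succ_lt hn))]
  linarith

theorem norm_logCutoff_le {s : ℝ → ℝ} (hs : IsCutoffProfile s) (n : ℕ) (z : ℂ) :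
    ‖logCutoff s n z‖ ≤ 1 ∧ ‖1 - logCutoff s n z‖ ≤ 1 := by
  rcases Nat.eq_zero_or_pos n with rfl | hn
  · simp [logCutoff_zero]
  · rw [logCutoff_of_pos s hn]
    exact norm_radialCutoff_le hs _ _ z

theorem logCutoff_eq_annularCutoff (s : ℝ → ℝ) {n : ℕ} (hn : 1 ≤ n) {z : ℂ}
    (hz : z ∈ annulus logRadius n) : logCutoff s n z = (annularCutoff s logRadius n z : ℂ) := by
  have h := sub_pos.2 (logRadius_succ_lt hn)
  rw [logCutoff_of_pos s hn, radialCutoff, clampedProfile_of_mem, annularCutoff]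
  exact ⟨div_nonneg (by linarith [hz.1]) h.le, (div_le_one h).2 (by linarith [hz.2])⟩

/-- Since the profile is locally constant at both ends of `[0, 1]`, only the cutoff of index `n` varies
in a neighbourhood of the closed `n`-th annulus. -/
theorem eventually_logCutoff {s : ℝ → ℝ} (hs : IsCutoffProfile s) {n : ℕ} (hn : 1 ≤ n) {z : ℂ}
    (hz : z ∈ annulus logRadius n) :
    ∀ᶠ w in 𝓝 z, (∀ m, n < m → logCutoff s m w = 1) ∧ ∀ m, m < n → logCutoff s m w = 0 := by
  have hnorm : Tendsto (fun w : ℂ => ‖w‖) (𝓝 z) (𝓝 ‖z‖) := continuous_norm.continuousAt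
  have h1 : ∀ᶠ w in 𝓝 z, (logRadius (n + 2) + 3 * logRadius (n + 1)) / 4 < ‖w‖ :=
    hnorm.eventually (lt_mem_nhds (by
      linarith [hz.1, logRadius_succ_lt (n := n + 1) (by omega)]))
  have h2 : ∀ᶠ w in 𝓝 z, n = 1 ∨ ‖w‖ < (3 * logRadius n + logRadius (n - 1)) / 4 := by
    rcases eq_or_ne n 1 with h | h
    · exact Eventually.of_forall fun _ => Or.inl h
    · have := logRadius_succ_lt (n := n - 1) (by omega)
      rw [Nat.sub_add_cancel hn] at this
      exact (hnorm.eventually (gt_mem_nhds (by linarith [hz.2]))).mono fun _ => Or.inr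
  filter_upwards [h1, h2] with w hw1 hw2
  refine ⟨fun m hm => logCutoff_eq_one hs (by omega) ?_, fun m hm => ?_⟩
  · linarith [logRadius_anti (m := n + 1) (n := m) (by omega) (by omega),
      logRadius_anti (m := n + 2) (n := m + 1) (by omega) (by omega)]
  · rcases Nat.eq_zero_or_pos m with rfl | hm0
    · exact logCutoff_zero s w
    · refine logCutoff_eq_zero hs ?_
      have := hw2.resolve_left (by omega)
      linarith [logRadius_anti (m := m) (n := n - 1) (by omega) (by omega),
        logRadius_anti (m := m + 1) (n := n) (by omega) (by omega)]

/-- The mixed component on the `n`-th annulus, with the extended cutoff. -/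
noncomputable def mixedPart (s : ℝ → ℝ) (n : ℕ) (z : ℂ) : ℂ :=
  logCutoff s n z * powerPart (fun n => n ^ 2) logCoeff (n - 1) z +
    (1 - logCutoff s n z) * powerPart (fun n => n ^ 2) logCoeff (n + 1) z

/-- The local form of the extension near a point of the closed `n`-th annulus, boundary circles
included. -/
theorem eventually_smoothLogMap_apply {s : ℝ → ℝ} (hs : IsCutoffProfile s) {n : ℕ} (hn : 1 ≤ n)
    {z : ℂ} (hz : z ∈ annulus logRadius n) (i : Fin 2) :
    (fun w => smoothLogMap s w i) =ᶠ[𝓝 z]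
      if n % 2 = (i : ℕ) then powerPart (fun n => n ^ 2) logCoeff n else mixedPart s n := by
  filter_upwards [eventually_logCutoff hs hn hz] with w hw
  obtain ⟨hw1, hw0⟩ := hw
  have hfar : ∀ m, m ∉ ({n - 1, n, n + 1} : Finset ℕ) →
      (if m % 2 = (i : ℕ) then cutoffMonomial s m w else 0) = 0 := by
    intro m hm
    simp only [Finset.mem_insert, Finset.mem_singleton, not_or] at hm
    have : cutoffMonomial s m w = 0 := by
      rcases lt_or_ge m n with h | h
      · simp [cutoffMonomial, hw0 (m + 1) (by omega)]
      · simp [cutoffMonomial, hw1 (m - 1) (by omega)]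
    simp [this]
  have hmid : cutoffMonomial s n w = powerPart (fun n => n ^ 2) logCoeff n w := by
    simp [cutoffMonomial, hw1 (n + 1) (by omega), hw0 (n - 1) (by omega)]
  have hlow : cutoffMonomial s (n - 1) w =
      logCutoff s n w * powerPart (fun n => n ^ 2) logCoeff (n - 1) w := by
    simp [cutoffMonomial, Nat.sub_add_cancel hn, hw0 (n - 1 - 1) (by omega)]
  have hhigh : cutoffMonomial s (n + 1) w =
      (1 - logCutoff s n w) * powerPart (fun n => n ^ 2) logCoeff (n + 1) w := by
    simp [cutoffMonomial, hw1 (n + 2) (by omega)]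
  have hi := i.2
  change (∑' m : ℕ, if m % 2 = (i : ℕ) then cutoffMonomial s m w else 0) = _
  rw [tsum_eq_sum hfar, Finset.sum_insert (by simp; omega), Finset.sum_insert (by simp),
    Finset.sum_singleton, hmid, hlow, hhigh]
  split_ifs <;> first | omega | simp [mixedPart]

theorem smoothLogMap_zero {s : ℝ → ℝ} (hs : IsCutoffProfile s) : smoothLogMap s 0 = 0 := by
  have h : ∀ n, cutoffMonomial s n 0 = 0 := by
    intro n
    rcases eq_or_ne n 0 with rfl | hn
    · have := logRadius_pos (n := 2) (by omega)
      have := logRadius_pos (n := 1) (by omega)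
      have : logCutoff s 1 0 = 0 := logCutoff_eq_zero hs (by simp; linarith)
      simp [cutoffMonomial, this]
    · simp [cutoffMonomial, powerPart, hn]
  ext i
  simp [smoothLogMap, h]

theorem logMap_zero (s : ℝ → ℝ) : logMap s 0 = 0 := by
  rw [logMap, annularMap, dif_neg]
  rintro ⟨n, hn, hz, -⟩
  rw [norm_zero] at hz
  exact absurd hz (not_le.2 (logRadius_pos (by omega)))

theorem smoothLogMap_eq_logMap {s : ℝ → ℝ} (hs : IsCutoffProfile s) {z : ℂ}
    (hz : z ∈ closedBall (0 : ℂ) (logRadius 1)) : smoothLogMap s z = logMap s z := by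
  rcases eq_or_ne z 0 with rfl | hz0
  · rw [smoothLogMap_zero hs, logMap_zero]
  obtain ⟨n, hn, hzn⟩ := exists_mem_annulus hz0 (by simpa using hz)
  have hmix : mixedPart s n z = transitionPart s logRadius (fun n => n ^ 2) logCoeff n z := by
    rw [mixedPart, transitionPart, logCutoff_eq_annularCutoff s hn hzn]
  rw [logMap, annularMap_eq _ _ (hs.eq_zero 0 (by norm_num)) (hs.eq_one 1 (by norm_num))
    (fun _ => logRadius_succ_lt) hn hzn]
  ext i
  rw [show smoothLogMap s z i = _ from (eventually_smoothLogMap_apply hs hn hzn i).self_of_nhds,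
    annularPiece]
  by_cases hp : Even n
  · have := Nat.even_iff.1 hp
    fin_cases i <;> simp [hp, this, hmix]
  · have := Nat.not_even_iff.1 hp
    fin_cases i <;> simp [hp, this, hmix]

theorem contDiff_powerPart (n : ℕ) : ContDiff ℝ ∞ (powerPart (fun n => n ^ 2) logCoeff n) := by
  unfold powerPart
  fun_prop

theorem contDiff_cutoffMonomial {s : ℝ → ℝ} (hs : IsCutoffProfile s) (n : ℕ) :
    ContDiff ℝ ∞ (cutoffMonomial s n) :=
  ((contDiff_logCutoff hs _).mul (contDiff_const.sub (contDiff_logCutoff hs _))).mul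
    (contDiff_powerPart n)

/-- The restriction `2 ≤ n` is needed: the first two terms have no outer cutoff. -/
theorem tsupport_cutoffMonomial_subset {s : ℝ → ℝ} (hs : IsCutoffProfile s) {n : ℕ} (hn : 2 ≤ n) :
    tsupport (cutoffMonomial s n) ⊆ {z | logRadius (n + 2) ≤ ‖z‖ ∧ ‖z‖ ≤ logRadius (n - 1)} := by
  refine closure_minimal (fun z hz => ?_) ((isClosed_le continuous_const continuous_norm).inter
    (isClosed_le continuous_norm continuous_const))
  by_contra hz'
  refine hz ?_
  simp only [mem_ofPred_eq, not_and_or, not_le] at hz'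
  rcases hz' with h | h
  · have := logRadius_succ_lt (n := n + 1) (by omega)
    have : logCutoff s (n + 1) z = 0 := logCutoff_eq_zero hs (by linarith)
    simp [cutoffMonomial, this]
  · have := logRadius_succ_lt (n := n - 1) (by omega)
    have : logCutoff s (n - 1) z = 1 := logCutoff_eq_one hs (by omega) (by linarith)
    simp [cutoffMonomial, this]

/-- Differentiating costs only powers of `n`: the widths of the annuli, their radii and the degrees
`n ^ 2` are all polynomially controlled. -/
theorem exists_bound_iteratedFDeriv_cutoffMonomial {s : ℝ → ℝ} (hs : IsCutoffProfile s) (k : ℕ) :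
    ∃ C : ℝ, ∀ n : ℕ, 2 ≤ n → ∀ z,
      ‖iteratedFDeriv ℝ k (cutoffMonomial s n) z‖ ≤
        C * ((n : ℝ) + 3) ^ (3 * k) * (logCoeff n * logRadius (n - 1) ^ n ^ 2) := by
  obtain ⟨C, hC1, hC⟩ := exists_derivBound_radialCutoff hs k
  refine ⟨C * C * (3 * C) ^ k, fun n hn z => ?_⟩
  have hF := logCoeff_pos n
  have hr := logRadius_pos (n := n - 1) (by omega)
  have hC0 : 0 ≤ C := by linarith
  by_cases hz : z ∈ {z : ℂ | logRadius (n + 2) ≤ ‖z‖ ∧ ‖z‖ ≤ logRadius (n - 1)}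
  swap
  · have : iteratedFDeriv ℝ k (cutoffMonomial s n) z = 0 := by
      by_contra h
      exact hz (tsupport_cutoffMonomial_subset hs hn (support_iteratedFDeriv_subset k h))
    rw [this, norm_zero]
    positivity
  set S := {z : ℂ | logRadius (n + 2) ≤ ‖z‖ ∧ ‖z‖ ≤ logRadius (n - 1)} with hS
  set L : ℝ := ((n : ℝ) + 3) ^ 3 with hL
  have hn0 : (0 : ℝ) ≤ n := by positivity
  have hL1 : 1 ≤ L := one_le_pow₀ (by linarith)
  have hSL : ∀ x ∈ S, x ≠ 0 ∧ ‖x‖⁻¹ ≤ L := by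
    intro x hx
    have hr2 := logRadius_pos (n := n + 2) (by omega)
    refine ⟨norm_pos_iff.1 (hr2.trans_le hx.1), (inv_anti₀ hr2 hx.1).trans ?_⟩
    refine inv_logRadius_le.trans ?_
    push_cast
    exact le_trans (by linarith) (le_self_pow₀ (by linarith : (1 : ℝ) ≤ n + 3) (by norm_num))
  have h1 : DerivBound k S C (C * L) (logCutoff s (n + 1)) := by
    rw [logCutoff_of_pos s (by omega)]
    refine (hC _ _ L (logRadius_pos (by omega)) (sub_pos.2 (logRadius_succ_lt (by omega))) hL1
      ?_ S hSL).1
    refine (inv_logRadius_sub_le_pow (by omega)).trans (le_of_eq ?_)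
    push_cast
    ring
  have h2 : DerivBound k S C (C * L) (fun z => 1 - logCutoff s (n - 1) z) := by
    rw [logCutoff_of_pos s (by omega)]
    refine (hC _ _ L (logRadius_pos (by omega)) (sub_pos.2 (logRadius_succ_lt (by omega))) hL1
      ?_ S hSL).2
    refine (inv_logRadius_sub_le_pow (by omega)).trans (pow_le_pow_left₀ (by positivity) ?_ 3)
    have : ((n - 1 : ℕ) : ℝ) ≤ n := by exact_mod_cast Nat.sub_le n 1
    linarith
  have h3 := (DerivBound.const k S (logCoeff n : ℂ)).mul
    (DerivBound.pow k hr (fun x hx => hx.2) (n ^ 2)) (by fun_prop) (by fun_prop)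
  have h4 := ((h1.mul h2 (contDiff_logCutoff hs _)
    (contDiff_const.sub (contDiff_logCutoff hs _))).mul h3
    ((contDiff_logCutoff hs _).mul (contDiff_const.sub (contDiff_logCutoff hs _)))
    (contDiff_powerPart n)) k le_rfl z hz
  rw [Complex.norm_real, Real.norm_of_nonneg hF.le, zero_add] at h4
  have h5 : ((n ^ 2 : ℕ) : ℝ) * (logRadius (n - 1))⁻¹ ≤ C * L := by
    have h6 : (logRadius (n - 1))⁻¹ ≤ n :=
      inv_logRadius_le.trans (by exact_mod_cast Nat.sub_le n 1)
    calc ((n ^ 2 : ℕ) : ℝ) * (logRadius (n - 1))⁻¹ ≤ (n : ℝ) ^ 2 * n := by push_cast; gcongr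
      _ = (n : ℝ) ^ 3 := by ring
      _ ≤ L := pow_le_pow_left₀ hn0 (by linarith) 3
      _ ≤ C * L := le_mul_of_one_le_left (by linarith) hC1
  calc _ ≤ _ := h4
    _ ≤ C * C * (logCoeff n * logRadius (n - 1) ^ n ^ 2) * (3 * C * L) ^ k := by
        gcongr
        linarith
    _ = _ := by
        rw [mul_pow, hL, ← pow_mul]; ring

theorem contDiff_smoothLogMap {s : ℝ → ℝ} (hs : IsCutoffProfile s) :
    ContDiff ℝ ∞ (smoothLogMap s) := by
  refine contDiff_piLp' 2 fun i => ?_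
  choose C hC using exists_bound_iteratedFDeriv_cutoffMonomial hs
  refine contDiff_tsum_of_eventually (𝕜 := ℝ) (F := ℂ) (N := ⊤)
    (f := fun n z => if n % 2 = (i : ℕ) then cutoffMonomial s n z else 0)
    (v := fun k n => |C k| * (((n : ℝ) + 3) ^ (3 * k) * Real.exp (-(n : ℝ))))
    (fun n => ?_) (fun k _ => ?_) fun k _ => ?_
  · split_ifs
    · exact contDiff_cutoffMonomial hs n
    · exact contDiff_const
  · refine Summable.mul_left _ ?_
    have h := ((summable_nat_add_iff 3).2
      (Real.summable_pow_mul_exp_neg_nat_mul (3 * k) one_pos)).mul_left (Real.exp 3)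
    refine h.congr fun n => ?_
    push_cast
    rw [mul_left_comm, ← Real.exp_add]
    congr 2
    ring
  · rw [Nat.cofinite_eq_atTop]
    filter_upwards [eventually_logCoeff_mul_pow_le, eventually_ge_atTop 2] with n hn hn2 z
    split_ifs
    · have hF := logCoeff_pos n
      have hr := logRadius_pos (n := n - 1) (by omega)
      refine (hC k n hn2 z).trans ?_
      rw [mul_assoc]
      gcongr
      exact le_abs_self _
    · have : iteratedFDeriv ℝ k (fun _ : ℂ => (0 : ℂ)) z = 0 := by
        simp [show (fun _ : ℂ => (0 : ℂ)) = 0 from rfl]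
      rw [this, norm_zero]
      positivity

/-! ### Wirtinger derivatives -/

theorem fderiv_euclidean_apply {v : ℂ → EuclideanSpace ℂ (Fin 2)} (hv : Differentiable ℝ v)
    (z : ℂ) (i : Fin 2) (y : ℂ) : fderiv ℝ v z y i = fderiv ℝ (fun w => v w i) z y := by
  have h := (hasFDerivWithinAt_piLp (t := univ) 2).1 (hv z).hasFDerivAt.hasFDerivWithinAt i
  rw [(h.hasFDerivAt univ_mem).fderiv]
  rfl

theorem wirtingerZ_univ_apply {v : ℂ → EuclideanSpace ℂ (Fin 2)} (hv : Differentiable ℝ v) (z : ℂ)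
    (i : Fin 2) : wirtingerZ univ v z i =
      1 / 2 * (fderiv ℝ (fun w => v w i) z 1 - Complex.I * fderiv ℝ (fun w => v w i) z Complex.I) := by
  simp [wirtingerZ, fderivWithin_univ, fderiv_euclidean_apply hv]

theorem wirtingerZBar_univ_apply {v : ℂ → EuclideanSpace ℂ (Fin 2)} (hv : Differentiable ℝ v)
    (z : ℂ) (i : Fin 2) : wirtingerZBar univ v z i =
      1 / 2 * (fderiv ℝ (fun w => v w i) z 1 + Complex.I * fderiv ℝ (fun w => v w i) z Complex.I) := by
  simp [wirtingerZBar, fderivWithin_univ, fderiv_euclidean_apply hv, mul_add]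

theorem HasDerivAt.fderiv_real_apply {g : ℂ → ℂ} {g' z : ℂ} (h : HasDerivAt g g' z) (w : ℂ) :
    fderiv ℝ g z w = g' * w := by
  rw [h.complexToReal_fderiv.fderiv]
  simp

/-- Only the cutoff contributes to the `z̄`-derivative of a convex combination of holomorphic
functions. -/
theorem norm_wirtingerZBar_interpolation_le {Z a b : ℂ → ℂ} {a' b' z : ℂ} {B : ℝ}
    (hZ : DifferentiableAt ℝ Z z) (ha : HasDerivAt a a' z) (hb : HasDerivAt b b' z)
    (hB : ‖fderiv ℝ Z z‖ ≤ B) :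
    ‖1 / 2 * (fderiv ℝ (fun w => Z w * a w + (1 - Z w) * b w) z 1 +
      Complex.I * fderiv ℝ (fun w => Z w * a w + (1 - Z w) * b w) z Complex.I)‖ ≤
      B * ‖a z - b z‖ := by
  have h := ((hZ.hasFDerivAt.mul ha.complexToReal_fderiv).add
    ((hZ.hasFDerivAt.const_sub 1).mul hb.complexToReal_fderiv)).fderiv
  have hfun : ∀ w : ℂ, fderiv ℝ (fun w => Z w * a w + (1 - Z w) * b w) z w =
      Z z * (a' * w) + fderiv ℝ Z z w * (a z - b z) + (1 - Z z) * (b' * w) := by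
    intro w
    rw [show fderiv ℝ (fun w => Z w * a w + (1 - Z w) * b w) z = _ from h]
    simp
    ring
  have h1 : ‖fderiv ℝ Z z 1‖ ≤ B := by
    simpa using (fderiv ℝ Z z).le_of_opNorm_le hB 1
  have h2 : ‖fderiv ℝ Z z Complex.I‖ ≤ B := by
    simpa using (fderiv ℝ Z z).le_of_opNorm_le hB Complex.I
  have e : 1 / 2 * (fderiv ℝ (fun w => Z w * a w + (1 - Z w) * b w) z 1 +
      Complex.I * fderiv ℝ (fun w => Z w * a w + (1 - Z w) * b w) z Complex.I) =
      1 / 2 * ((fderiv ℝ Z z 1 + Complex.I * fderiv ℝ Z z Complex.I) * (a z - b z)) := by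
    rw [hfun, hfun]
    linear_combination (1 / 2 * (Z z * a' + (1 - Z z) * b')) * Complex.I_mul_I
  have h3 : ‖fderiv ℝ Z z 1 + Complex.I * fderiv ℝ Z z Complex.I‖ ≤ 2 * B := by
    refine (norm_add_le _ _).trans ?_
    rw [norm_mul, Complex.norm_I]
    linarith
  rw [e, norm_mul, norm_mul]
  calc ‖(1 / 2 : ℂ)‖ * (‖fderiv ℝ Z z 1 + Complex.I * fderiv ℝ Z z Complex.I‖ * ‖a z - b z‖)
      ≤ 1 / 2 * ((2 * B) * ‖a z - b z‖) := by
        gcongr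
        norm_num
    _ = _ := by ring

theorem exists_norm_fderiv_logCutoff_le {s : ℝ → ℝ} (hs : IsCutoffProfile s) :
    ∃ M : ℝ, 0 ≤ M ∧ ∀ n : ℕ, 1 ≤ n → ∀ z,
      ‖fderiv ℝ (logCutoff s n) z‖ ≤ M * (logRadius n - logRadius (n + 1))⁻¹ := by
  obtain ⟨M, hM⟩ := exists_lipschitzWith_clampedProfile hs
  refine ⟨M, M.2, fun n hn z => ?_⟩
  have hδ := sub_pos.2 (logRadius_succ_lt hn)
  refine norm_fderiv_le_of_lip' ℝ (by positivity) (Eventually.of_forall fun w => ?_)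
  rw [logCutoff_of_pos s hn]
  have h := hM.dist_le_mul ((‖w‖ - logRadius (n + 1)) / (logRadius n - logRadius (n + 1)))
    ((‖z‖ - logRadius (n + 1)) / (logRadius n - logRadius (n + 1)))
  rw [dist_eq_norm] at h
  refine h.trans ?_
  rw [mul_assoc]
  gcongr
  rw [Real.dist_eq, ← sub_div, abs_div, abs_of_pos hδ, div_eq_inv_mul]
  gcongr
  rw [sub_sub_sub_cancel_right]
  exact abs_norm_sub_norm_le w z

theorem norm_powerPart (n : ℕ) (z : ℂ) :
    ‖powerPart (fun n => n ^ 2) logCoeff n z‖ = logCoeff n * ‖z‖ ^ n ^ 2 := by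
  rw [powerPart, norm_mul, norm_pow, Complex.norm_real, Real.norm_of_nonneg (logCoeff_pos n).le]

theorem hasDerivAt_powerPart (n : ℕ) (z : ℂ) :
    HasDerivAt (powerPart (fun n => n ^ 2) logCoeff n)
      (logCoeff n * (((n ^ 2 : ℕ) : ℂ) * z ^ (n ^ 2 - 1))) z :=
  (hasDerivAt_pow (n ^ 2) z).const_mul _

theorem EuclideanSpace.norm_le_add_of_fin_two (x : EuclideanSpace ℂ (Fin 2)) :
    ‖x‖ ≤ ‖x 0‖ + ‖x 1‖ := by
  rw [EuclideanSpace.norm_eq, Fin.sum_univ_two]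
  refine Real.sqrt_le_iff.2 ⟨by positivity, ?_⟩
  nlinarith [norm_nonneg (x 0), norm_nonneg (x 1)]

/-- The form in which the two components of the map are estimated: the bound `A` is for the component
with the parity of `n`, the bound `B` for the other one. -/
theorem EuclideanSpace.norm_le_of_parity (n : ℕ) {x : EuclideanSpace ℂ (Fin 2)} {A B : ℝ}
    (hA : ∀ i : Fin 2, n % 2 = (i : ℕ) → ‖x i‖ ≤ A)
    (hB : ∀ i : Fin 2, n % 2 ≠ (i : ℕ) → ‖x i‖ ≤ B) : ‖x‖ ≤ A + B := by
  refine (norm_le_add_of_fin_two x).trans ?_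
  rcases Nat.mod_two_eq_zero_or_one n with h | h
  · exact add_le_add (hA 0 (by simpa using h)) (hB 1 (by simp [h]))
  · rw [add_comm A]
    exact add_le_add (hB 0 (by simp [h])) (hA 1 (by simpa using h))

/-! ### Estimates on an annulus -/

/-- On the `n`-th annulus both neighbouring monomials are dominated by the derivative of the `n`-th
one, up to the factor `n ^ 2` that the differentiation produces. -/
theorem exists_norm_powerPart_neighbours_le : ∃ C : ℝ, 0 < C ∧ ∀ n : ℕ, 1 ≤ n → ∀ z : ℂ,
    z ∈ annulus logRadius n →
      ‖powerPart (fun n => n ^ 2) logCoeff (n - 1) z‖ +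
        ‖powerPart (fun n => n ^ 2) logCoeff (n + 1) z‖ ≤
      C * (logCoeff n * ‖z‖ ^ (n ^ 2 - 1)) := by
  obtain ⟨C, hC0, hC⟩ := exists_logCoeff_succ_mul_pow_le
  refine ⟨1 + C, by positivity, fun n hn z hz => ?_⟩
  obtain ⟨m, rfl⟩ : ∃ m, n = m + 1 := ⟨n - 1, by omega⟩
  have h1 := logCoeff_mul_pow_le (n := m) hz.1
  have h2 := hC (m + 1) hn ‖z‖ (norm_nonneg z) hz.2
  rw [norm_powerPart, norm_powerPart, Nat.add_sub_cancel, add_mul, one_mul]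
  exact add_le_add h1 h2

/-- The constant is `9 * 2`, from `(n + 2) ^ 2 ≤ 9 * n ^ 2` and `ln (n + 2) ≤ 2 * ln (n + 1)`. -/
theorem inv_width_div_sq_le {n : ℕ} (hn : 1 ≤ n) {z : ℂ} (hz : z ∈ annulus logRadius n) :
    (logRadius n - logRadius (n + 1))⁻¹ / (n : ℝ) ^ 2 ≤
      18 / (‖z‖ ^ 2 * Real.exp (1 / ‖z‖)) := by
  have hρ : 0 < ‖z‖ := (logRadius_pos (by omega)).trans_le hz.1
  have hn1 : (1 : ℝ) ≤ n := by exact_mod_cast hn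
  have h1 := log_natCast_pos (n := n + 1) (by omega)
  have h2 := log_natCast_pos (n := n + 2) (by omega)
  have h12 : Real.log ((n + 2 : ℕ) : ℝ) ≤ 2 * Real.log ((n + 1 : ℕ) : ℝ) := by
    rw [← Real.log_rpow (by positivity)]
    apply Real.log_le_log (by positivity)
    norm_cast
    nlinarith
  have h3 : ‖z‖ * Real.log ((n + 1 : ℕ) : ℝ) ≤ 1 := by
    have := hz.2
    rwa [logRadius_eq, le_inv_comm₀ hρ h1, le_inv_comm₀ h1 hρ, ← one_div, le_div_iff₀ h1] at this
  have h4 : Real.exp (1 / ‖z‖) ≤ n + 2 := by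
    have := hz.1
    rw [logRadius_eq, inv_le_comm₀ h2 hρ, Real.le_log_iff_exp_le (by positivity)] at this
    rw [one_div]
    exact_mod_cast this
  have h5 : ((n : ℝ) + 2) ^ 2 ≤ 9 * n ^ 2 := by nlinarith
  rw [div_le_div_iff₀ (by positivity) (by positivity)]
  calc (logRadius n - logRadius (n + 1))⁻¹ * (‖z‖ ^ 2 * Real.exp (1 / ‖z‖))
      ≤ ((n + 2) * (Real.log ((n + 1 : ℕ) : ℝ) * (2 * Real.log ((n + 1 : ℕ) : ℝ)))) *
          (‖z‖ ^ 2 * (n + 2)) := by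
        gcongr
        refine (inv_logRadius_sub_le hn).trans ?_
        gcongr
    _ = 2 * (n + 2) ^ 2 * (‖z‖ * Real.log ((n + 1 : ℕ) : ℝ)) ^ 2 := by ring
    _ ≤ 2 * (9 * n ^ 2) * 1 := by
        gcongr
        exact pow_le_one₀ (by positivity) h3
    _ = 18 * n ^ 2 := by ring

theorem wirtingerZ_smoothLogMap_apply {s : ℝ → ℝ} (hs : IsCutoffProfile s) {n : ℕ} (hn : 1 ≤ n)
    {z : ℂ} (hz : z ∈ annulus logRadius n) {i : Fin 2} (hi : n % 2 = (i : ℕ)) :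
    wirtingerZ univ (smoothLogMap s) z i =
      logCoeff n * (((n ^ 2 : ℕ) : ℂ) * z ^ (n ^ 2 - 1)) := by
  have h := (eventually_smoothLogMap_apply hs hn hz i).fderiv_eq (𝕜 := ℝ)
  rw [if_pos hi] at h
  rw [wirtingerZ_univ_apply ((contDiff_smoothLogMap hs).differentiable (by simp)), h,
    (hasDerivAt_powerPart n z).fderiv_real_apply, (hasDerivAt_powerPart n z).fderiv_real_apply]
  linear_combination (-1 / 2 * (logCoeff n * (((n ^ 2 : ℕ) : ℂ) * z ^ (n ^ 2 - 1)))) *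
    Complex.I_mul_I

theorem le_norm_wirtingerZ_smoothLogMap {s : ℝ → ℝ} (hs : IsCutoffProfile s) {n : ℕ} (hn : 1 ≤ n)
    {z : ℂ} (hz : z ∈ annulus logRadius n) :
    (n : ℝ) ^ 2 * (logCoeff n * ‖z‖ ^ (n ^ 2 - 1)) ≤ ‖wirtingerZ univ (smoothLogMap s) z‖ := by
  obtain ⟨i, hi⟩ : ∃ i : Fin 2, n % 2 = (i : ℕ) := ⟨⟨n % 2, Nat.mod_lt _ two_pos⟩, rfl⟩
  refine le_trans (le_of_eq ?_) (PiLp.norm_apply_le _ i)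
  rw [wirtingerZ_smoothLogMap_apply hs hn hz hi, norm_mul, norm_mul, norm_pow, Complex.norm_real,
    Real.norm_of_nonneg (logCoeff_pos n).le, Complex.norm_natCast]
  push_cast
  ring

theorem wirtingerZ_smoothLogMap_ne_zero {s : ℝ → ℝ} (hs : IsCutoffProfile s) {z : ℂ}
    (hz : z ≠ 0) (hz1 : ‖z‖ ≤ logRadius 1) : wirtingerZ univ (smoothLogMap s) z ≠ 0 := by
  obtain ⟨n, hn, hzn⟩ := exists_mem_annulus hz hz1
  have hF := logCoeff_pos n
  have hρ := norm_pos_iff.2 hz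
  have hn0 : (0 : ℝ) < n := by exact_mod_cast hn
  exact norm_pos_iff.1 (lt_of_lt_of_le (by positivity) (le_norm_wirtingerZ_smoothLogMap hs hn hzn))

theorem exists_norm_wirtingerZBar_smoothLogMap_le {s : ℝ → ℝ} (hs : IsCutoffProfile s) :
    ∃ C : ℝ, 0 < C ∧ ∀ z : ℂ, z ≠ 0 → ‖z‖ ≤ logRadius 1 →
      ‖wirtingerZBar univ (smoothLogMap s) z‖ / ‖wirtingerZ univ (smoothLogMap s) z‖ ≤
        C / (‖z‖ ^ 2 * Real.exp (1 / ‖z‖)) := by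
  obtain ⟨M, hM0, hM⟩ := exists_norm_fderiv_logCutoff_le hs
  obtain ⟨C, hC0, hC⟩ := exists_norm_powerPart_neighbours_le
  refine ⟨(M + 1) * C * 18, by positivity, fun z hz hz1 => ?_⟩
  obtain ⟨n, hn, hzn⟩ := exists_mem_annulus hz hz1
  have hdiff : Differentiable ℝ (smoothLogMap s) :=
    (contDiff_smoothLogMap hs).differentiable (by simp)
  have hδ := sub_pos.2 (logRadius_succ_lt hn)
  have hn0 : (0 : ℝ) < n := by exact_mod_cast hn
  set W := ‖wirtingerZ univ (smoothLogMap s) z‖ with hW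
  have hW0 : 0 < W := norm_pos_iff.2 (wirtingerZ_smoothLogMap_ne_zero hs hz hz1)
  have hbar : ‖wirtingerZBar univ (smoothLogMap s) z‖ ≤
      0 + M * (logRadius n - logRadius (n + 1))⁻¹ *
        ‖powerPart (fun n => n ^ 2) logCoeff (n - 1) z -
          powerPart (fun n => n ^ 2) logCoeff (n + 1) z‖ := by
    refine EuclideanSpace.norm_le_of_parity n (fun i hi => ?_) fun i hi => ?_
    · have h := (eventually_smoothLogMap_apply hs hn hzn i).fderiv_eq (𝕜 := ℝ)
      rw [if_pos hi] at h
      rw [wirtingerZBar_univ_apply hdiff, h, (hasDerivAt_powerPart n z).fderiv_real_apply,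
        (hasDerivAt_powerPart n z).fderiv_real_apply, norm_le_zero_iff]
      linear_combination (1 / 2 * (logCoeff n * (((n ^ 2 : ℕ) : ℂ) * z ^ (n ^ 2 - 1)))) *
        Complex.I_mul_I
    · have h := (eventually_smoothLogMap_apply hs hn hzn i).fderiv_eq (𝕜 := ℝ)
      rw [if_neg hi] at h
      rw [wirtingerZBar_univ_apply hdiff, h]
      exact norm_wirtingerZBar_interpolation_le
        (((contDiff_logCutoff hs n).differentiable (by simp)) z) (hasDerivAt_powerPart _ z)
        (hasDerivAt_powerPart _ z) (hM n hn z)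
  have h1 : (n : ℝ) ^ 2 * (logCoeff n * ‖z‖ ^ (n ^ 2 - 1)) ≤ W :=
    le_norm_wirtingerZ_smoothLogMap hs hn hzn
  have h2 : logCoeff n * ‖z‖ ^ (n ^ 2 - 1) ≤ W / (n : ℝ) ^ 2 := by
    rw [le_div_iff₀ (by positivity)]
    linarith
  rw [div_le_iff₀ hW0]
  calc ‖wirtingerZBar univ (smoothLogMap s) z‖
      ≤ M * (logRadius n - logRadius (n + 1))⁻¹ *
        ‖powerPart (fun n => n ^ 2) logCoeff (n - 1) z -
          powerPart (fun n => n ^ 2) logCoeff (n + 1) z‖ := by linarith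
    _ ≤ (M + 1) * (logRadius n - logRadius (n + 1))⁻¹ * (C * (W / (n : ℝ) ^ 2)) := by
        gcongr
        · linarith
        · exact (norm_sub_le _ _).trans ((hC n hn z hzn).trans (by gcongr))
    _ = (M + 1) * C * ((logRadius n - logRadius (n + 1))⁻¹ / (n : ℝ) ^ 2) * W := by ring
    _ ≤ (M + 1) * C * (18 / (‖z‖ ^ 2 * Real.exp (1 / ‖z‖))) * W := by
        have := inv_width_div_sq_le hn hzn
        exact mul_le_mul_of_nonneg_right (mul_le_mul_of_nonneg_left this (by positivity)) hW0.le
    _ = _ := by ring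

theorem smoothLogMap_ne_zero {s : ℝ → ℝ} (hs : IsCutoffProfile s) {z : ℂ}
    (hz : z ≠ 0) (hz1 : ‖z‖ ≤ logRadius 1) : smoothLogMap s z ≠ 0 := by
  obtain ⟨n, hn, hzn⟩ := exists_mem_annulus hz hz1
  obtain ⟨i, hi⟩ : ∃ i : Fin 2, n % 2 = (i : ℕ) := ⟨⟨n % 2, Nat.mod_lt _ two_pos⟩, rfl⟩
  intro h0
  have h := (eventually_smoothLogMap_apply hs hn hzn i).self_of_nhds
  rw [if_pos hi] at h
  have h1 := norm_powerPart n z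
  rw [← h] at h1
  have hF := logCoeff_pos n
  have hρ := norm_pos_iff.2 hz
  have : 0 < logCoeff n * ‖z‖ ^ n ^ 2 := by positivity
  simp only [h0, PiLp.zero_apply, norm_zero] at h1
  linarith

theorem exists_norm_smoothLogMap_le {s : ℝ → ℝ} (hs : IsCutoffProfile s) :
    ∃ C : ℝ, ∀ z : ℂ, z ≠ 0 → ‖z‖ ≤ logRadius 1 →
      ‖smoothLogMap s z‖ ≤ C / (‖z‖ ^ 2 * Real.exp (1 / ‖z‖)) := by
  obtain ⟨C, hC0, hC⟩ := exists_norm_powerPart_neighbours_le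
  obtain ⟨K, hK0, hK⟩ := exists_logCoeff_mul_pow_le
  have hr1 := logRadius_pos (n := 1) le_rfl
  refine ⟨(logRadius 1 ^ 2 + C * logRadius 1) * (K * Real.exp 1), fun z hz hz1 => ?_⟩
  obtain ⟨n, hn, hzn⟩ := exists_mem_annulus hz hz1
  have hρ := norm_pos_iff.2 hz
  have hF := logCoeff_pos n
  have hnorm : ‖smoothLogMap s z‖ ≤
      logCoeff n * ‖z‖ ^ n ^ 2 + C * (logCoeff n * ‖z‖ ^ (n ^ 2 - 1)) := by
    refine EuclideanSpace.norm_le_of_parity n (fun i hi => ?_) fun i hi => ?_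
    · have h := (eventually_smoothLogMap_apply hs hn hzn i).self_of_nhds
      rw [if_pos hi] at h
      exact le_of_eq ((congrArg norm h).trans (norm_powerPart n z))
    · have h := (eventually_smoothLogMap_apply hs hn hzn i).self_of_nhds
      rw [if_neg hi] at h
      refine (le_of_eq (congrArg norm h)).trans (le_trans ?_ (hC n hn z hzn))
      rw [mixedPart]
      refine (norm_add_le _ _).trans ?_
      rw [norm_mul, norm_mul]
      obtain ⟨hZ1, hZ2⟩ := norm_logCutoff_le hs n z
      exact add_le_add (mul_le_of_le_one_left (norm_nonneg _) hZ1)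
        (mul_le_of_le_one_left (norm_nonneg _) hZ2)
  have he : Real.exp (-(n : ℝ)) * Real.exp (1 / ‖z‖) ≤ Real.exp 1 := by
    rw [← Real.exp_add, Real.exp_le_exp]
    have h1 := inv_anti₀ (logRadius_pos (by omega)) hzn.1
    have h2 := inv_logRadius_le (n := n + 1)
    push_cast at h2
    rw [one_div]
    linarith
  have hpow : ‖z‖ ^ (n ^ 2 - 1) * ‖z‖ = ‖z‖ ^ n ^ 2 :=
    pow_sub_one_mul (pow_pos hn 2).ne' _
  rw [le_div_iff₀ (by positivity)]
  calc ‖smoothLogMap s z‖ * (‖z‖ ^ 2 * Real.exp (1 / ‖z‖))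
      ≤ (logCoeff n * ‖z‖ ^ n ^ 2 + C * (logCoeff n * ‖z‖ ^ (n ^ 2 - 1))) *
          (‖z‖ ^ 2 * Real.exp (1 / ‖z‖)) := by gcongr
    _ = (‖z‖ ^ 2 + C * ‖z‖) * ((logCoeff n * ‖z‖ ^ n ^ 2) * Real.exp (1 / ‖z‖)) := by
        rw [← hpow]; ring
    _ ≤ (logRadius 1 ^ 2 + C * logRadius 1) *
          ((K * Real.exp (-(n : ℝ))) * Real.exp (1 / ‖z‖)) := by
        refine mul_le_mul ?_ ?_ (by positivity) (by positivity)
        · gcongr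
        · exact mul_le_mul_of_nonneg_right (hK n hn ‖z‖ hρ.le hzn.2) (Real.exp_pos _).le
    _ ≤ _ := by
        rw [mul_assoc K]
        gcongr

/-! ### Infinite order of vanishing -/

/-- Domination by `exp (-1 / |z|) / |z| ^ 2` near the origin suffices. -/
theorem vanishesToInfiniteOrder_of_le {E : Type*} [NormedAddCommGroup E] {f : ℂ → E} {C ρ : ℝ}
    (hρ : 0 < ρ)
    (h : ∀ z : ℂ, z ≠ 0 → ‖z‖ ≤ ρ → ‖f z‖ ≤ C / (‖z‖ ^ 2 * Real.exp (1 / ‖z‖))) :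
    VanishesToInfiniteOrder f := by
  intro k
  have hlim : Tendsto (fun z : ℂ => C * (‖z‖⁻¹ ^ (k + 2) * Real.exp (-‖z‖⁻¹))) (𝓝[≠] 0) (𝓝 0) := by
    have := ((Real.tendsto_pow_mul_exp_neg_atTop_nhds_zero (k + 2)).comp
      (tendsto_inv_nhdsGT_zero.comp (tendsto_norm_nhdsNE_zero (E := ℂ)))).const_mul C
    rw [mul_zero] at this
    exact this
  refine squeeze_zero' (Eventually.of_forall fun z => by positivity) ?_ hlim
  filter_upwards [self_mem_nhdsWithin, mem_nhdsWithin_of_mem_nhds (ball_mem_nhds (0 : ℂ) hρ)]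
    with z hz hzρ
  have hz0 : 0 < ‖z‖ := norm_pos_iff.2 hz
  rw [mem_ball_zero_iff] at hzρ
  rw [div_le_iff₀ (by positivity)]
  refine (h z hz hzρ.le).trans (le_of_eq ?_)
  rw [one_div, Real.exp_neg, pow_add, inv_pow, inv_pow]
  field_simp

theorem VanishesToInfiniteOrder.tendsto_norm {E : Type*} [NormedAddCommGroup E] {f : ℂ → E}
    (hf : VanishesToInfiniteOrder f) : Tendsto (fun z => ‖f z‖) (𝓝[≠] 0) (𝓝 0) := by
  simpa using hf 0

theorem VanishesToInfiniteOrder.hasFDerivAt_zero {E : Type*} [NormedAddCommGroup E]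
    [NormedSpace ℝ E] {f : ℂ → E} (hf : VanishesToInfiniteOrder f) (h0 : f 0 = 0) :
    HasFDerivAt f (0 : ℂ →L[ℝ] E) 0 := by
  rw [hasFDerivAt_iff_isLittleO_nhds_zero, Asymptotics.isLittleO_iff]
  intro c hc
  have h := eventually_nhdsWithin_iff.1 ((hf 1).eventually (gt_mem_nhds hc))
  filter_upwards [h] with z hz
  rcases eq_or_ne z 0 with rfl | hz0
  · simp [h0]
  · have h1 := (div_lt_iff₀ (by simpa using hz0)).1 (hz hz0)
    simpa [h0] using h1.le

/-! ### The Beltrami system -/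

/-- One-sided Wirtinger derivatives on `S` are those of any differentiable extension to the plane. -/
theorem wirtinger_eq_of_eqOn {S : Set ℂ} {f g : ℂ → EuclideanSpace ℂ (Fin 2)}
    (hS : UniqueDiffOn ℝ S) (hg : Differentiable ℝ g) (hfg : EqOn f g S) {z : ℂ} (hz : z ∈ S) :
    wirtingerZ S f z = wirtingerZ univ g z ∧ wirtingerZBar S f z = wirtingerZBar univ g z := by
  have h : fderivWithin ℝ f S z = fderivWithin ℝ g univ z := by
    rw [fderivWithin_congr hfg (hfg hz), (hg z).fderivWithin (hS z hz), fderivWithin_univ]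
  simp only [wirtingerZ, wirtingerZBar, h, and_self]

theorem VanishesToInfiniteOrder.wirtingerZBar_zero {S : Set ℂ} {f : ℂ → EuclideanSpace ℂ (Fin 2)}
    (hf : VanishesToInfiniteOrder f) (h0 : f 0 = 0) (hS : UniqueDiffWithinAt ℝ S 0) :
    wirtingerZBar S f 0 = 0 := by
  have h := hf.hasFDerivAt_zero h0
  have hd : fderivWithin ℝ f S 0 = 0 := h.hasFDerivWithinAt.fderivWithin hS
  simp [wirtingerZBar, hd]

theorem continuous_wirtinger_univ {v : ℂ → EuclideanSpace ℂ (Fin 2)} (hv : ContDiff ℝ ∞ v) :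
    Continuous (wirtingerZ univ v) ∧ Continuous (wirtingerZBar univ v) := by
  have h : Continuous (fderiv ℝ v) := hv.continuous_fderiv (by simp)
  constructor
  · unfold wirtingerZ
    simp only [fderivWithin_univ]
    fun_prop
  · unfold wirtingerZBar
    simp only [fderivWithin_univ]
    fun_prop

theorem beltramiMatrix_apply (S : Set ℂ) (u : ℂ → EuclideanSpace ℂ (Fin 2)) {z : ℂ} (hz : z ≠ 0)
    (i j : Fin 2) : beltramiMatrix S u z i j =
      wirtingerZBar S u z i * conj (wirtingerZ S u z j) / ((‖wirtingerZ S u z‖ : ℂ) ^ 2) := by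
  rw [beltramiMatrix, if_neg hz, Matrix.of_apply]

theorem norm_beltramiMatrix_le (S : Set ℂ) (u : ℂ → EuclideanSpace ℂ (Fin 2)) {z : ℂ} (hz : z ≠ 0)
    (i j : Fin 2) :
    ‖beltramiMatrix S u z i j‖ ≤ ‖wirtingerZBar S u z‖ / ‖wirtingerZ S u z‖ := by
  rw [beltramiMatrix_apply S u hz, norm_div, norm_mul, RCLike.norm_conj, norm_pow,
    Complex.norm_real, norm_norm]
  rcases eq_or_ne ‖wirtingerZ S u z‖ 0 with h | h
  · simp [h]
  · have h0 : 0 < ‖wirtingerZ S u z‖ := lt_of_le_of_ne (norm_nonneg _) h.symm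
    rw [div_le_div_iff₀ (by positivity) h0]
    have h1 := PiLp.norm_apply_le (wirtingerZBar S u z) i
    have h2 := PiLp.norm_apply_le (wirtingerZ S u z) j
    calc ‖wirtingerZBar S u z i‖ * ‖wirtingerZ S u z j‖ * ‖wirtingerZ S u z‖
        ≤ ‖wirtingerZBar S u z‖ * ‖wirtingerZ S u z‖ * ‖wirtingerZ S u z‖ := by gcongr
      _ = _ := by ring

/-- The matrix is the rank one operator that sends `u_z` to `u_{z̄}`. -/
theorem sum_beltramiMatrix_mul (S : Set ℂ) (u : ℂ → EuclideanSpace ℂ (Fin 2)) {z : ℂ} (hz : z ≠ 0)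
    (h : wirtingerZ S u z ≠ 0) (i : Fin 2) :
    ∑ j, beltramiMatrix S u z i j * wirtingerZ S u z j = wirtingerZBar S u z i := by
  have h0 : ((‖wirtingerZ S u z‖ : ℂ) ^ 2) ≠ 0 :=
    pow_ne_zero 2 (by exact_mod_cast norm_ne_zero_iff.2 h)
  have hsq : ((‖wirtingerZ S u z‖ : ℂ) ^ 2) =
      ∑ j, conj (wirtingerZ S u z j) * wirtingerZ S u z j := by
    simp_rw [Complex.conj_mul']
    exact_mod_cast EuclideanSpace.norm_sq_eq (wirtingerZ S u z)
  have hterm : ∀ j, beltramiMatrix S u z i j * wirtingerZ S u z j =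
      wirtingerZBar S u z i / ((‖wirtingerZ S u z‖ : ℂ) ^ 2) *
        (conj (wirtingerZ S u z j) * wirtingerZ S u z j) := by
    intro j
    rw [beltramiMatrix_apply S u hz]
    ring
  simp_rw [hterm]
  rw [← Finset.mul_sum, ← hsq, div_mul_cancel₀ _ h0]

/-- Entries of size at most `1 / 8` make `Q z` an operator of norm at most `1 / 2`. -/
theorem isUniformlyElliptic_of_norm_le {Q : ℂ → Matrix (Fin 2) (Fin 2) ℂ} {S : Set ℂ}
    (hQ : ∀ z ∈ S, ∀ i j, ‖Q z i j‖ ≤ 1 / 8) : IsUniformlyElliptic Q S := by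
  refine ⟨1 / 2, by norm_num, fun z hz ζ w => ?_⟩
  set y : EuclideanSpace ℂ (Fin 2) := WithLp.toLp 2 fun i => ∑ j, Q z i j * w j with hy
  have hyi : ∀ i, ‖y i‖ ≤ 1 / 4 * ‖w‖ := by
    intro i
    change ‖∑ j, Q z i j * w j‖ ≤ _
    rw [Fin.sum_univ_two]
    refine (norm_add_le _ _).trans ?_
    rw [norm_mul, norm_mul]
    have h0 := mul_le_mul (hQ z hz i 0) (PiLp.norm_apply_le w 0) (norm_nonneg _) (by norm_num)
    have h1 := mul_le_mul (hQ z hz i 1) (PiLp.norm_apply_le w 1) (norm_nonneg _) (by norm_num)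
    linarith
  have hyn : ‖y‖ ≤ 1 / 2 * ‖w‖ := by
    linarith [EuclideanSpace.norm_le_add_of_fin_two y, hyi 0, hyi 1]
  have hvec : (WithLp.toLp 2 fun i => ζ * w i - conj ζ * ∑ j, Q z i j * w j :
      EuclideanSpace ℂ (Fin 2)) = ζ • w - conj ζ • y := by
    ext i
    simp [hy]
  rw [hvec]
  have h := norm_sub_norm_le (ζ • w) (conj ζ • y)
  rw [norm_smul, norm_smul, RCLike.norm_conj] at h
  nlinarith [mul_le_mul_of_nonneg_left hyn (norm_nonneg ζ)]

theorem mainTheorem1 :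
    (∃ s : ℝ → ℝ, IsCutoffProfile s) ∧
    ∀ s : ℝ → ℝ, IsCutoffProfile s →
      ∀ (D : Set ℂ) (_ : D = closedBall (0 : ℂ) (logRadius 1))
        (u : ℂ → EuclideanSpace ℂ (Fin 2)) (_ : u = logMap s)
        (Q : ℂ → Matrix (Fin 2) (Fin 2) ℂ) (_ : Q = beltramiMatrix D u),
      -- `u` is smooth, with an isolated zero of infinite order at the origin
      ContDiffOn ℝ ∞ u D ∧
      u 0 = 0 ∧
      (∀ z ∈ D, z ≠ 0 → u z ≠ 0) ∧
      VanishesToInfiniteOrder u ∧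
      -- the ratio of the derivatives is defined, and it is flat at the origin
      (∀ z ∈ D, z ≠ 0 → wirtingerZ D u z ≠ 0) ∧
      (∃ C : ℝ, 0 < C ∧ ∀ z ∈ D, z ≠ 0 →
        ‖wirtingerZBar D u z‖ / ‖wirtingerZ D u z‖ ≤ C / (‖z‖ ^ 2 * Real.exp (1 / ‖z‖))) ∧
      VanishesToInfiniteOrder (fun z => ‖wirtingerZBar D u z‖ / ‖wirtingerZ D u z‖) ∧
      -- `u` solves a Beltrami-type system without the strong unique continuation property
      ContinuousOn Q D ∧
      (∀ i j, VanishesToInfiniteOrder (fun z => Q z i j)) ∧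
      SolvesBeltrami Q D u ∧
      (∃ ρ : ℝ, 0 < ρ ∧ ρ ≤ logRadius 1 ∧ IsUniformlyElliptic Q (ball 0 ρ)) ∧
      (∀ ρ : ℝ, 0 < ρ → ρ ≤ logRadius 1 → ¬ HasStrongUniqueContinuation Q (ball 0 ρ)) := by
  refine ⟨exists_isCutoffProfile, fun s hs D hD u hu Q hQ => ?_⟩
  have hr1 : 0 < logRadius 1 := logRadius_pos le_rfl
  set v := smoothLogMap s with hv
  have hvs : ContDiff ℝ ∞ v := contDiff_smoothLogMap hs
  have hvd : Differentiable ℝ v := hvs.differentiable (by simp)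
  have hmem : ∀ z, z ∈ D ↔ ‖z‖ ≤ logRadius 1 := fun z => by rw [hD, mem_closedBall_zero_iff]
  have huv : EqOn u v D := fun z hz => by
    rw [hu, hv, smoothLogMap_eq_logMap hs (hD ▸ hz)]
  have hDu : UniqueDiffOn ℝ D := by
    rw [hD]
    refine uniqueDiffOn_convex (convex_closedBall _ _) ⟨0, ?_⟩
    exact interior_mono ball_subset_closedBall
      (by rw [isOpen_ball.interior_eq]; exact mem_ball_self hr1)
  have hW : ∀ z ∈ D, wirtingerZ D u z = wirtingerZ univ v z ∧
      wirtingerZBar D u z = wirtingerZBar univ v z := fun z hz =>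
    wirtinger_eq_of_eqOn hDu hvd huv hz
  have hu0 : u 0 = 0 := by rw [hu, logMap_zero]
  have hne : ∀ z ∈ D, z ≠ 0 → u z ≠ 0 := fun z hz hz0 => by
    rw [huv hz]
    exact smoothLogMap_ne_zero hs hz0 ((hmem z).1 hz)
  have hvan : VanishesToInfiniteOrder u := by
    obtain ⟨C, hC⟩ := exists_norm_smoothLogMap_le hs
    refine vanishesToInfiniteOrder_of_le (C := C) hr1 fun z hz hz1 => ?_
    rw [huv ((hmem z).2 hz1)]
    exact hC z hz hz1
  have hzne : ∀ z ∈ D, z ≠ 0 → wirtingerZ D u z ≠ 0 := fun z hz hz0 => by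
    rw [(hW z hz).1]
    exact wirtingerZ_smoothLogMap_ne_zero hs hz0 ((hmem z).1 hz)
  obtain ⟨C, hC0, hC⟩ : ∃ C : ℝ, 0 < C ∧ ∀ z ∈ D, z ≠ 0 →
      ‖wirtingerZBar D u z‖ / ‖wirtingerZ D u z‖ ≤ C / (‖z‖ ^ 2 * Real.exp (1 / ‖z‖)) := by
    obtain ⟨C, hC0, hC⟩ := exists_norm_wirtingerZBar_smoothLogMap_le hs
    refine ⟨C, hC0, fun z hz hz0 => ?_⟩
    rw [(hW z hz).1, (hW z hz).2]
    exact hC z hz0 ((hmem z).1 hz)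
  have hratio : VanishesToInfiniteOrder
      (fun z => ‖wirtingerZBar D u z‖ / ‖wirtingerZ D u z‖) := by
    refine vanishesToInfiniteOrder_of_le (C := C) hr1 fun z hz hz1 => ?_
    rw [Real.norm_of_nonneg (by positivity)]
    exact hC z ((hmem z).2 hz1) hz
  have hQvan : ∀ i j, VanishesToInfiniteOrder (fun z => Q z i j) := fun i j => by
    refine vanishesToInfiniteOrder_of_le (C := C) hr1 fun z hz hz1 => ?_
    rw [hQ]
    exact (norm_beltramiMatrix_le D u hz i j).trans (hC z ((hmem z).2 hz1) hz)
  have hQ0 : Q 0 = 0 := by rw [hQ, beltramiMatrix, if_pos rfl]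
  have hQcont0 : ∀ i j, ContinuousAt (fun z => Q z i j) 0 := fun i j => by
    rw [← continuousWithinAt_compl_self, ContinuousWithinAt, hQ0]
    exact tendsto_zero_iff_norm_tendsto_zero.2 (hQvan i j).tendsto_norm
  have hQcont : ContinuousOn Q D := by
    intro z hz
    refine continuousWithinAt_pi.2 fun i => continuousWithinAt_pi.2 fun j => ?_
    rcases eq_or_ne z 0 with rfl | hz0
    · exact (hQcont0 i j).continuousWithinAt
    obtain ⟨c1, c2⟩ := continuous_wirtinger_univ hvs
    have hcont : ContinuousAt (fun z => wirtingerZBar univ v z i * conj (wirtingerZ univ v z j) /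
        ((‖wirtingerZ univ v z‖ : ℂ) ^ 2)) z := by
      have d1 : Continuous fun z => wirtingerZ univ v z j :=
        (PiLp.continuous_apply 2 (fun _ => ℂ) j).comp c1
      have d2 : Continuous fun z => wirtingerZBar univ v z i :=
        (PiLp.continuous_apply 2 (fun _ => ℂ) i).comp c2
      refine (d2.mul (Complex.continuous_conj.comp d1)).continuousAt.div
        ((Complex.continuous_ofReal.comp c1.norm).pow 2).continuousAt (pow_ne_zero 2 ?_)
      rw [← (hW z hz).1]
      exact Complex.ofReal_ne_zero.2 (norm_ne_zero_iff.2 (hzne z hz hz0))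
    refine hcont.continuousWithinAt.congr_of_eventuallyEq_of_mem ?_ hz
    filter_upwards [self_mem_nhdsWithin,
      mem_nhdsWithin_of_mem_nhds (isOpen_compl_singleton.mem_nhds hz0)] with w hw hw0
    rw [hQ, beltramiMatrix_apply D u hw0, (hW w hw).1, (hW w hw).2]
  have hsolve : ∀ S ⊆ D, UniqueDiffOn ℝ S → SolvesBeltrami Q S u := by
    intro S hSD hSu z hz i
    obtain ⟨e1, e2⟩ := wirtinger_eq_of_eqOn hSu hvd (huv.mono hSD) hz
    rw [← (hW z (hSD hz)).1] at e1
    rw [← (hW z (hSD hz)).2] at e2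
    rw [e1, e2]
    rcases eq_or_ne z 0 with rfl | hz0
    · have h0D : (0 : ℂ) ∈ D := hSD hz
      rw [hvan.wirtingerZBar_zero hu0 (hDu 0 h0D), hQ0]
      simp
    · rw [hQ]
      exact (sum_beltramiMatrix_mul D u hz0 (hzne z (hSD hz) hz0) i).symm
  refine ⟨hvs.contDiffOn.congr huv, hu0, hne, hvan, hzne, ⟨C, hC0, hC⟩, hratio, hQcont, hQvan,
    hsolve D Subset.rfl hDu, ?_, fun ρ hρ hρ1 hsucp => ?_⟩
  · have hev : ∀ᶠ z in 𝓝 (0 : ℂ), ∀ i j, ‖Q z i j‖ ≤ 1 / 8 := by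
      refine eventually_all.2 fun i => eventually_all.2 fun j => ?_
      have h := (hQcont0 i j).norm
      have h0 : ‖Q 0 i j‖ < 1 / 8 := by simp [hQ0]
      exact (h.eventually (gt_mem_nhds h0)).mono fun z hz => hz.le
    obtain ⟨ε, hε, hball⟩ := Metric.eventually_nhds_iff_ball.1 hev
    exact ⟨min ε (logRadius 1), lt_min hε hr1, min_le_right _ _,
      isUniformlyElliptic_of_norm_le fun z hz => hball z (ball_subset_ball (min_le_left _ _) hz)⟩
  · have hsub : ball (0 : ℂ) ρ ⊆ D := fun z hz =>
      (hmem z).2 ((mem_ball_zero_iff.1 hz).le.trans hρ1)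
    have hzero := hsucp u (hvs.contDiffOn.congr (huv.mono hsub))
      (hsolve _ hsub isOpen_ball.uniqueDiffOn) hvan
    have hball : ∀ᶠ z in 𝓝[≠] (0 : ℂ), z ∈ ball (0 : ℂ) ρ :=
      mem_nhdsWithin_of_mem_nhds (ball_mem_nhds 0 hρ)
    obtain ⟨z, hz, hzρ, hz0⟩ := ((hzero.filter_mono nhdsWithin_le_nhds).and
      (hball.and self_mem_nhdsWithin)).exists
    exact hne z (hsub hzρ) hz0 hz
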